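/- **Theorem 3.** Let $\xi=(\xi_t)_{t\in[0,1]}$ be a subordinator: $\xi_0=0$ a.s., the increments are independent and stationary, and the paths are a.s. right-continuous and non-decreasing. Let $\psi(s)=-\log\mathbb E[e^{-s\xi_1}]$, $s\ge 0$, be its Laplace exponent. Assume that $\xi$ has no drift, i.e. $\psi(s)=\int_0^\infty(1-e^{-sy})\,\nu(dy)$ for all $s\ge0$, where the Lévy measure $\nu$ on $(0,\infty)$ satisfies $\int_0^\infty\min\{1,y\}\,\nu(dy)<\infty$, and that $\xi$ has infinite activity, i.e. $\nu((0,\infty))=\infty$. For $n\ge1$ let $w_i=\xi_{i/n}-\xi_{(i-1)/n}$ and $p_i=w_i/\sum_{j=1}^n w_j$, $i=1,\dots,n$. Consider the Move-to-Front Markov chain on the orderings of $n$ items: at each step, independently, item $i$ is requested with probability $p_i$ and is moved to the front of the list, the order of the other items being unchanged. Let $S_n$ be the stationary search cost: conditionally on the weights, draw an ordering from the stationary distribution of the chain and, independently, an item $R$ with $P(R=i)=p_i$; then $S_n$ is the number of items preceding $R$ in the ordering. (a) The function $\psi$ is twice continuously differentiable on $(0,\infty)$, and as $n\to\infty$, $S_n$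 converges in distribution to a random variable $S$ with values in $\{0,1,2,\dots\}$ whose Laplace transform is, for every $s\ge0$, $$\phi_S(s)=\mathbb E[e^{-sS}]=\lim_{n\to\infty}\mathbb E[e^{-sS_n}]=-\int_0^\infty\!\!\int_0^\infty\psi''(x+y)\,e^{-\psi(x+y)}\,e^{-e^{-s}[\psi(x)-\psi(x+y)]}\,dx\,dy,$$ the integral being absolutely convergent. (b) $S$ is a mixed Poisson variable: $f(x,y)=-\psi''(x+y)e^{-\psi(x)}$ is a probability density on $(0,\infty)^2$, and the law of $S$ is the mixture, with respect to $f(x,y)\,dx\,dy$, of the Poisson distributions with parameter $\psi(x+y)-\psi(x)\ge0$. (c) For $n,l\ge1$ let $$I_n(l)=\int_0^\infty e^{-\frac{n-2}{n}\psi(r)}\int_0^\infty[\psi'(r+t)]^2e^{-\frac2n\psi(r+t)}[\psi(r+t)-\psi(r)]^{l-1}\,dt\,dr .$$ If $k\ge1$ is an integer such that $\sup_{n\ge1}I_n(l)<\infty$ for $l=1,\dots,k$, then $$\lim_{n\to\infty}\mathbb E[S_n^k]=\sum_{l=1}^kS(k,l)\,\Psi(l),$$ where the $S(k,l)$ are the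 Stirling numbers of the second kind and $$\Psi(l)=-\int_0^\infty\!\!\int_0^\infty[\psi(x+y)-\psi(x)]^l\,\psi''(x+y)\,e^{-\psi(x)}\,dx\,dy,$$ these integrals being absolutely convergent for $l=1,\dots,k$. -/

import Mathlib

open Set Filter Topology MeasureTheory ProbabilityTheory
open scoped ENNReal NNReal

/-! ### Subordinators on the unit interval and their Laplace exponents -/

/-- A subordinator `ξ = (ξ_t)_{t ∈ [0,1]}`: a real-valued process started at `0`, with independent
and stationary increments and almost surely right-continuous non-decreasing paths.
Only the values of `ξ` at times in `[0,1]` matter. -/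
structure IsSubordinator {Ω : Type*} [MeasurableSpace Ω] (P : Measure Ω) (ξ : ℝ → Ω → ℝ) :
    Prop where
  measurable : ∀ t ∈ Icc (0 : ℝ) 1, Measurable (ξ t)
  indep_increments : HasIndepIncrements (fun t : Icc (0 : ℝ) 1 => ξ t) P
  zero : ∀ᵐ ω ∂P, ξ 0 ω = 0
  stationary_increments : ∀ s t : ℝ, 0 ≤ s → s ≤ t → t ≤ 1 →
    IdentDistrib (fun ω => ξ t ω - ξ s ω) (ξ (t - s)) P P
  paths : ∀ᵐ ω ∂P, MonotoneOn (fun t => ξ t ω) (Icc 0 1) ∧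
    ∀ t ∈ Ico (0 : ℝ) 1, ContinuousWithinAt (fun t => ξ t ω) (Ici t) t

/-- The Laplace exponent `ψ(s) = - log E[exp(- s ξ_1)]`, for `s ≥ 0`. Because the increments are
stationary and independent, it also equals `- (1/t) log E[exp(- s ξ_t)]` for `t ∈ (0,1]`. -/
noncomputable def laplaceExponent {Ω : Type*} [MeasurableSpace Ω] (P : Measure Ω)
    (ξ : ℝ → Ω → ℝ) (s : ℝ) : ℝ :=
  -Real.log (∫ ω, Real.exp (-s * ξ 1 ω) ∂P)

/-- `ξ` is a pure-jump (i.e. driftless) subordinator with Lévy measure `ν` on `(0,∞)`: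
`∫ min(1,y) ν(dy) < ∞` and `ψ(s) = ∫ (1 - exp(-s y)) ν(dy)` for all `s ≥ 0`. -/
structure HasLevyMeasure {Ω : Type*} [MeasurableSpace Ω] (P : Measure Ω) (ξ : ℝ → Ω → ℝ)
    (ν : Measure ℝ) : Prop where
  lintegral_min_lt_top : ∫⁻ y in Ioi (0 : ℝ), ENNReal.ofReal (min 1 y) ∂ν < ∞
  laplaceExponent_eq : ∀ s : ℝ, 0 ≤ s →
    laplaceExponent P ξ s = ∫ y in Ioi (0 : ℝ), (1 - Real.exp (-s * y)) ∂ν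

/-- The increments `ξ_{i/n} - ξ_{(i-1)/n}`, `i = 1, …, n`, over `n` equal subintervals of `[0,1]`
(indexed from `0`). -/
noncomputable def incrementWeights {Ω : Type*} (ξ : ℝ → Ω → ℝ) (n : ℕ) (ω : Ω) (i : Fin n) : ℝ :=
  ξ (((i : ℕ) + 1 : ℝ) / n) ω - ξ (((i : ℕ) : ℝ) / n) ω

/-- The request probabilities `p_i = w_i / ∑_j w_j` defined by weights `w`. -/
noncomputable def requestProb {n : ℕ} (w : Fin n → ℝ) (i : Fin n) : ℝ :=
  w i / ∑ j, w j

/-! ### The Move-to-Front Markov chain and its search cost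

A heap of `n` items is a permutation `σ`, where `σ i` is the position of item `i`;
position `0` is the front (top) of the heap. -/

/-- Item `i` is moved to the front of the heap `σ`; the items which preceded it are moved back by
one position and all others keep their position. -/
def moveToFront {n : ℕ} (i : Fin n) (σ : Equiv.Perm (Fin n)) : Equiv.Perm (Fin n) :=
  σ.trans (σ i).cycleRange

/-- The transition matrix of the Move-to-Front chain in which item `i` is requested with
probability `p i`. -/
noncomputable def mtfTransition {n : ℕ} (p : Fin n → ℝ) :
    Matrix (Equiv.Perm (Fin n)) (Equiv.Perm (Fin n)) ℝ :=
  fun σ τ => ∑ i, if moveToFront i σ = τ then p i else 0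

/-- `π` is a stationary probability distribution of the Move-to-Front chain with request
probabilities `p`. -/
def IsMtfStationary {n : ℕ} (p : Fin n → ℝ) (π : Equiv.Perm (Fin n) → ℝ) : Prop :=
  π ∈ stdSimplex ℝ (Equiv.Perm (Fin n)) ∧ Matrix.vecMul π (mtfTransition p) = π

/-- The search cost of item `i` in the heap `σ`: the number of items preceding it. -/
def itemSearchCost {n : ℕ} (σ : Equiv.Perm (Fin n)) (i : Fin n) : ℕ :=
  (Finset.univ.filter fun j => σ j < σ i).card

/-- `S` is the stationary search cost for the random weights `w`: there are a random heap `σ` and a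
random requested item `R` such that, conditionally on the weights, `σ` and `R` are independent, `σ`
follows a stationary distribution of the Move-to-Front chain with request probabilities
`p = requestProb w`, `R` equals `i` with probability `p i`, and `S` is the search cost of the item
`R` in the heap `σ`. -/
def IsStationarySearchCost {Ω : Type*} [MeasurableSpace Ω] (P : Measure Ω) {n : ℕ}
    (w : Ω → Fin n → ℝ) (S : Ω → ℕ) : Prop :=
  ∃ (σ : Ω → Equiv.Perm (Fin n)) (R : Ω → Fin n),
    (∀ τ, MeasurableSet {ω | σ ω = τ}) ∧ Measurable R ∧
    (∃ π : Ω → Equiv.Perm (Fin n) → ℝ,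
      (∀ᵐ ω ∂P, IsMtfStationary (requestProb (w ω)) (π ω)) ∧
      ∀ (τ : Equiv.Perm (Fin n)) (i : Fin n),
        P⟦{ω | σ ω = τ ∧ R ω = i} | MeasurableSpace.comap w inferInstance⟧
          =ᵐ[P] fun ω => π ω τ * requestProb (w ω) i) ∧
    ∀ ω, S ω = itemSearchCost (σ ω) (R ω)

/-! ### The quantities attached to a Laplace exponent `ψ` -/

/-- The open quadrant `(0,∞)²`. -/
def quadrant : Set (ℝ × ℝ) := Ioi 0 ×ˢ Ioi 0

/-- The integrand
`ψ''(x+y) exp(-ψ(x+y)) exp(-exp(-s) (ψ(x) - ψ(x+y)))`. -/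
noncomputable def laplaceIntegrand (ψ : ℝ → ℝ) (s x y : ℝ) : ℝ :=
  deriv (deriv ψ) (x + y) * Real.exp (-ψ (x + y)) *
    Real.exp (-Real.exp (-s) * (ψ x - ψ (x + y)))

/-- The limiting Laplace transform
`φ_S(s) = -∫₀^∞ ∫₀^∞ ψ''(x+y) exp(-ψ(x+y)) exp(-exp(-s) (ψ(x) - ψ(x+y))) dx dy`. -/
noncomputable def limitLaplace (ψ : ℝ → ℝ) (s : ℝ) : ℝ :=
  -∫ y in Ioi (0 : ℝ), ∫ x in Ioi (0 : ℝ), laplaceIntegrand ψ s x y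

/-- The random Poisson parameter `ψ(x+y) - ψ(x)`. -/
noncomputable def mixingRate (ψ : ℝ → ℝ) (x y : ℝ) : ℝ := ψ (x + y) - ψ x

/-- The mixing density `f(x,y) = -ψ''(x+y) exp(-ψ(x))`. -/
noncomputable def mixingDensity (ψ : ℝ → ℝ) (x y : ℝ) : ℝ :=
  -deriv (deriv ψ) (x + y) * Real.exp (-ψ x)

/-- The measure on `(0,∞)²` with density `f`. -/
noncomputable def mixingMeasure (ψ : ℝ → ℝ) : Measure (ℝ × ℝ) :=
  (volume.restrict quadrant).withDensity fun z => ENNReal.ofReal (mixingDensity ψ z.1 z.2)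

/-- `I_n(l) = ∫₀^∞ exp(-((n-2)/n) ψ(r)) ∫₀^∞ ψ'(r+t)² exp(-(2/n) ψ(r+t)) (ψ(r+t) - ψ(r))^(l-1) dt dr`,
as an element of `[0,∞]`. -/
noncomputable def mtfI (ψ : ℝ → ℝ) (n l : ℕ) : ℝ≥0∞ :=
  ∫⁻ r in Ioi (0 : ℝ), ENNReal.ofReal (Real.exp (-(((n : ℝ) - 2) / n) * ψ r)) *
    ∫⁻ t in Ioi (0 : ℝ), ENNReal.ofReal
      (deriv ψ (r + t) ^ 2 * Real.exp (-(2 / (n : ℝ)) * ψ (r + t)) *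
        (ψ (r + t) - ψ r) ^ (l - 1))

/-- The integrand `(ψ(x+y) - ψ(x))^l ψ''(x+y) exp(-ψ(x))`. -/
noncomputable def momentIntegrand (ψ : ℝ → ℝ) (l : ℕ) (x y : ℝ) : ℝ :=
  (ψ (x + y) - ψ x) ^ l * deriv (deriv ψ) (x + y) * Real.exp (-ψ x)

/-- `Ψ(l) = -∫₀^∞ ∫₀^∞ (ψ(x+y) - ψ(x))^l ψ''(x+y) exp(-ψ(x)) dx dy`. -/
noncomputable def mtfPsi (ψ : ℝ → ℝ) (l : ℕ) : ℝ :=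
  -∫ y in Ioi (0 : ℝ), ∫ x in Ioi (0 : ℝ), momentIntegrand ψ l x y

/-!
Let `φ = exp (-ψ / n)` be the Laplace transform of the increments, which are independent and
identically distributed, and almost surely positive by infinite activity.

*The stationary law.* Under the stationary distribution of the Move-to-Front chain the items are
ordered as independent exponential times with rates `w`. Indeed, the probability that all items of
`A` precede `i` and `i` precedes all items of `C` satisfies a balance equation which determines it
by induction on `A` (`separationWeight_balance`); the corresponding probability for exponential times
satisfies the same equation (`integral_clockIntegrand_balance`).

*The search cost is a binomial mixture.* Writing `p i` as the integral of `w i * exp (-(∑ j, w j) x)`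
removes the random normalization, and independence turns the expectation of the product over the
items into a product of values of `φ` and `φ''` (`IsStationarySearchCost.measure_eq`). In terms of
`ψ`, the search cost of `n` items is a mixture of the binomial laws with `n - 1` trials and success
probability `1 - exp (-r / n)`, `r = ψ (x + y) - ψ x`, with respect to the density
`(ψ'(x + y) ^ 2 / n - ψ''(x + y)) * exp (-ψ x) * exp (-r / n)`
(`IsSubordinator.measure_searchCost`).

*Weak convergence.* As `n → ∞` the density converges pointwise to the mixing density and the
binomial probabilities to Poisson probabilities. The limit has mass one because `ψ` increases from `0`
to infinity (infinite activity) and `ψ'` vanishes at infinity (no drift). Since the limit law is a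
probability measure, Fatou's lemma and the portmanteau theorem give convergence in distribution
without any domination.

*Moments.* The `l`-th factorial moment of the binomial mixture is, up to the factor
`(n - 1) ⋯ (n - l) / n ^ l → 1`, the integral of the density against the `l`-th power of
`n * (1 - exp (-r / n))`. Integration by parts in `y` (`lintegral_mul_ofReal_primitive`) turns it
into the integral of
`l * ψ'(x + y) ^ 2 * exp (-ψ x) * exp (-2 r / n) * (n * (1 - exp (-r / n))) ^ (l - 1)`,
which is dominated by its pointwise limit. That limit is integrable by Fatou's lemma applied to the
integrals `I_n(l)`, and a second integration by parts, with `1 / n` replaced by `0`, identifies its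
integral with `Ψ(l)`. Stirling numbers of the second kind convert factorial moments to moments.
-/

/-! ### The stationary distribution of the Move-to-Front chain -/

lemma Fin.cycleRange_lt_cycleRange_iff {n : ℕ} (k a c : Fin n) :
    k.cycleRange a < k.cycleRange c ↔ c ≠ k ∧ (a = k ∨ a < c) := by
  have key : ∀ x : Fin n, ((k.cycleRange x : Fin n) : ℕ) =
      if x = k then 0 else if x < k then (x : ℕ) + 1 else x := by
    intro x
    rcases lt_trichotomy x k with h | h | h
    · rw [Fin.coe_cycleRange_of_lt h, if_neg h.ne, if_pos h]
    · rw [Fin.coe_cycleRange_of_le h.le]; simp [h]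
    · rw [Fin.cycleRange_of_gt h, if_neg h.ne', if_neg h.not_gt]
  rw [Fin.lt_def, key, key]
  simp only [Fin.lt_def, Fin.ext_iff, ne_eq]
  split_ifs <;> omega

lemma moveToFront_lt_moveToFront_iff {n : ℕ} (b x y : Fin n) (σ : Equiv.Perm (Fin n)) :
    moveToFront b σ x < moveToFront b σ y ↔ y ≠ b ∧ (x = b ∨ σ x < σ y) := by
  simp [moveToFront, Fin.cycleRange_lt_cycleRange_iff]

/-- In the heap `σ`, all items of `A` precede item `i`, which precedes all items of `C`. -/
def Separates {n : ℕ} (A C : Finset (Fin n)) (i : Fin n) (σ : Equiv.Perm (Fin n)) : Prop :=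
  (∀ a ∈ A, σ a < σ i) ∧ ∀ c ∈ C, σ i < σ c

instance {n : ℕ} (A C : Finset (Fin n)) (i : Fin n) : DecidablePred (Separates A C i) :=
  fun _ => inferInstanceAs (Decidable (_ ∧ _))

/-- Stationarity, tested against a function `F` of the heap. -/
lemma IsMtfStationary.sum_mul_eq {n : ℕ} {p : Fin n → ℝ} {π : Equiv.Perm (Fin n) → ℝ}
    (h : IsMtfStationary p π) (F : Equiv.Perm (Fin n) → ℝ) :
    ∑ τ, π τ * F τ = ∑ b, p b * ∑ σ, π σ * F (moveToFront b σ) := by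
  calc ∑ τ, π τ * F τ = ∑ τ, (∑ σ, π σ * mtfTransition p σ τ) * F τ := by
        refine Finset.sum_congr rfl fun τ _ => ?_
        conv_lhs => rw [← h.2]
        rfl
    _ = ∑ τ, ∑ σ, ∑ b, π σ * (if moveToFront b σ = τ then p b else 0) * F τ := by
        simp only [mtfTransition, Finset.mul_sum, Finset.sum_mul]
    _ = ∑ σ, ∑ b, ∑ τ, π σ * (if moveToFront b σ = τ then p b else 0) * F τ := by
        rw [Finset.sum_comm]
        exact Finset.sum_congr rfl fun σ _ => Finset.sum_comm
    _ = ∑ σ, ∑ b, p b * (π σ * F (moveToFront b σ)) := by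
        refine Finset.sum_congr rfl fun σ _ => Finset.sum_congr rfl fun b _ => ?_
        rw [Finset.sum_eq_single (moveToFront b σ)]
        · simp; ring
        · intro τ _ hτ; simp [Ne.symm hτ]
        · simp
    _ = _ := by
        rw [Finset.sum_comm]
        simp only [Finset.mul_sum]

/-- The weight which `π` gives to the heaps in which `A` precedes `i` and `i` precedes `C`. -/
noncomputable def separationWeight {n : ℕ} (π : Equiv.Perm (Fin n) → ℝ) (A C : Finset (Fin n))
    (i : Fin n) : ℝ :=
  ∑ σ, π σ * if Separates A C i σ then 1 else 0

/-- The probability that `A` precedes `i` and `i` precedes `C` after a request of item `b`. -/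
lemma sum_separates_moveToFront {n : ℕ} {p : Fin n → ℝ} {π : Equiv.Perm (Fin n) → ℝ}
    (h : IsMtfStationary p π) {A C : Finset (Fin n)} {i : Fin n} (hiA : i ∉ A) (hiC : i ∉ C)
    (hAC : Disjoint A C) (b : Fin n) :
    ∑ σ, π σ * (if Separates A C i (moveToFront b σ) then (1 : ℝ) else 0) =
      if b ∈ A then separationWeight π (A.erase b) C i
      else if b = i then (if A = ∅ then 1 else 0)
      else if b ∈ C then 0 else separationWeight π A C i := by
  have hsep : ∀ σ, Separates A C i (moveToFront b σ) ↔
      (∀ a ∈ A, i ≠ b ∧ (a = b ∨ σ a < σ i)) ∧ ∀ c ∈ C, c ≠ b ∧ (i = b ∨ σ i < σ c) := by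
    intro σ; simp only [Separates, moveToFront_lt_moveToFront_iff]
  simp only [hsep]
  split_ifs with h1 h2 h3 h4
  · refine Finset.sum_congr rfl fun σ _ => ?_
    congr 2
    rw [Separates, eq_iff_iff]
    have hib : i ≠ b := fun e => hiA (e ▸ h1)
    have hbC : ∀ c ∈ C, c ≠ b := fun c hc e => Finset.disjoint_left.1 hAC h1 (e ▸ hc)
    constructor
    · rintro ⟨ha, hc⟩
      refine ⟨fun a haA => ?_, fun c hcC => ?_⟩
      · have := (ha a (Finset.mem_of_mem_erase haA)).2
        exact this.resolve_left (Finset.ne_of_mem_erase haA)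
      · exact (hc c hcC).2.resolve_left hib
    · rintro ⟨ha, hc⟩
      refine ⟨fun a haA => ⟨hib, ?_⟩, fun c hcC => ⟨hbC c hcC, Or.inr (hc c hcC)⟩⟩
      by_cases hab : a = b
      · exact Or.inl hab
      · exact Or.inr (ha a (Finset.mem_erase.2 ⟨hab, haA⟩))
  · have : ∀ c ∈ C, c ≠ b ∧ (i = b ∨ True) := by
      subst h2; exact fun c hc => ⟨fun e => hiC (e ▸ hc), Or.inl rfl⟩
    refine Eq.trans (Finset.sum_congr rfl fun σ _ => ?_) h.1.2
    rw [if_pos, mul_one]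
    subst h3
    exact ⟨by simp, fun c hc => ⟨(this c hc).1, Or.inl h2.symm⟩⟩
  · refine Finset.sum_eq_zero fun σ _ => ?_
    rw [if_neg, mul_zero]
    obtain ⟨a, ha⟩ := Finset.nonempty_iff_ne_empty.2 h3
    exact fun hh => (hh.1 a ha).1 h2.symm
  · refine Finset.sum_eq_zero fun σ _ => ?_
    rw [if_neg, mul_zero]
    exact fun hh => (hh.2 b h4).1 rfl
  · refine Finset.sum_congr rfl fun σ _ => ?_
    congr 2
    rw [Separates, eq_iff_iff]
    refine and_congr (forall₂_congr fun a ha => ?_) (forall₂_congr fun c hc => ?_)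
    · have : a ≠ b := fun e => h1 (e ▸ ha)
      simp [this, Ne.symm h2]
    · have : c ≠ b := fun e => h4 (e ▸ hc)
      simp [this, Ne.symm h2]

/-- The balance equation of the event that `A` precedes `i` and `i` precedes `C`: only requests in
`A ∪ {i} ∪ C` change the event, and a request of `a ∈ A` leaves the condition on `A \ {a}`. -/
lemma separationWeight_balance {n : ℕ} {p : Fin n → ℝ} {π : Equiv.Perm (Fin n) → ℝ}
    (h : IsMtfStationary p π) (hp : ∑ b, p b = 1) {A C : Finset (Fin n)} {i : Fin n}
    (hiA : i ∉ A) (hiC : i ∉ C) (hAC : Disjoint A C) :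
    (∑ a ∈ A, p a + p i + ∑ c ∈ C, p c) * separationWeight π A C i =
      ∑ a ∈ A, p a * separationWeight π (A.erase a) C i + if A = ∅ then p i else 0 := by
  have hbal : separationWeight π A C i = ∑ b, p b *
      (if b ∈ A then separationWeight π (A.erase b) C i
      else if b = i then (if A = ∅ then 1 else 0)
      else if b ∈ C then 0 else separationWeight π A C i) := by
    conv_lhs => rw [separationWeight, h.sum_mul_eq]
    exact Finset.sum_congr rfl fun b _ => by rw [sum_separates_moveToFront h hiA hiC hAC]
  set V := separationWeight π A C i
  have e1 : ∀ b, p b *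
      (if b ∈ A then separationWeight π (A.erase b) C i
      else if b = i then (if A = ∅ then 1 else 0)
      else if b ∈ C then 0 else V) =
      (if b ∈ A then p b * separationWeight π (A.erase b) C i else 0)
      + (if b = i then (if A = ∅ then p b else 0) else 0)
      + (p b * V - (if b ∈ A then p b * V else 0) - (if b = i then p b * V else 0)
        - (if b ∈ C then p b * V else 0)) := by
    intro b
    by_cases h1 : b ∈ A
    · have h2 : b ≠ i := fun e => hiA (e ▸ h1)
      have h3 : b ∉ C := Finset.disjoint_left.1 hAC h1
      simp [h1, h2, h3]
    · by_cases h2 : b = i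
      · have h3 : b ∉ C := h2 ▸ hiC
        simp [h2, hiA, hiC]
      · by_cases h3 : b ∈ C <;> simp [h1, h2, h3]
  simp only [e1, Finset.sum_add_distrib, Finset.sum_sub_distrib, Finset.sum_ite_mem,
    Finset.univ_inter, Finset.sum_ite_eq', Finset.mem_univ, if_true, ← Finset.sum_mul, hp,
    one_mul] at hbal
  linarith

/-- The density at `t` of the following event for independent exponential times with rates `w`: the
time of `i` is `t`, those of `A` are smaller and those of `C` are larger. -/
noncomputable def clockIntegrand {n : ℕ} (w : Fin n → ℝ) (A C : Finset (Fin n)) (i : Fin n)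
    (t : ℝ) : ℝ :=
  w i * Real.exp (-(w i + ∑ c ∈ C, w c) * t) * ∏ a ∈ A, (1 - Real.exp (-w a * t))

section clock
variable {n : ℕ} {w : Fin n → ℝ}

lemma prod_one_sub_exp_mem_Icc (hw : ∀ j, 0 < w j) (A : Finset (Fin n)) {t : ℝ} (ht : 0 ≤ t) :
    ∏ a ∈ A, (1 - Real.exp (-w a * t)) ∈ Icc (0 : ℝ) 1 := by
  have h : ∀ a, Real.exp (-w a * t) ≤ 1 := fun a => by
    rw [Real.exp_le_one_iff]; nlinarith [hw a]
  exact ⟨Finset.prod_nonneg fun a _ => by linarith [h a],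
    Finset.prod_le_one (fun a _ => by linarith [h a]) fun a _ => by
      linarith [Real.exp_pos (-w a * t)]⟩

lemma clockIntegrand_nonneg (hw : ∀ j, 0 < w j) (A C : Finset (Fin n)) (i : Fin n) {t : ℝ}
    (ht : 0 ≤ t) : 0 ≤ clockIntegrand w A C i t :=
  mul_nonneg (mul_nonneg (hw i).le (Real.exp_pos _).le) (prod_one_sub_exp_mem_Icc hw A ht).1

lemma continuous_clockIntegrand (w : Fin n → ℝ) (A C : Finset (Fin n)) (i : Fin n) :
    Continuous (clockIntegrand w A C i) := by
  unfold clockIntegrand; fun_prop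

lemma rate_pos (hw : ∀ j, 0 < w j) (C : Finset (Fin n)) (i : Fin n) : 0 < w i + ∑ c ∈ C, w c :=
  add_pos_of_pos_of_nonneg (hw i) (Finset.sum_nonneg fun c _ => (hw c).le)

lemma integrableOn_clockIntegrand (hw : ∀ j, 0 < w j) (A C : Finset (Fin n)) (i : Fin n) :
    IntegrableOn (clockIntegrand w A C i) (Ioi 0) := by
  have hD := rate_pos hw C i
  refine Integrable.mono' ((integrableOn_exp_mul_Ioi (neg_lt_zero.2 hD) 0).const_mul (w i))
    (continuous_clockIntegrand w A C i).aestronglyMeasurable ?_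
  refine (ae_restrict_mem measurableSet_Ioi).mono fun t ht => ?_
  rw [Real.norm_of_nonneg (clockIntegrand_nonneg hw A C i ht.le), clockIntegrand]
  exact mul_le_of_le_one_right (mul_nonneg (hw i).le (Real.exp_pos _).le)
    (prod_one_sub_exp_mem_Icc hw A ht.le).2

/-- The exponential-clock integrals satisfy the balance equation of the Move-to-Front chain. -/
lemma integral_clockIntegrand_balance (hw : ∀ j, 0 < w j) (A C : Finset (Fin n)) (i : Fin n) :
    (∑ a ∈ A, w a + w i + ∑ c ∈ C, w c) * ∫ t in Ioi 0, clockIntegrand w A C i t =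
      ∑ a ∈ A, w a * (∫ t in Ioi 0, clockIntegrand w (A.erase a) C i t) +
        if A = ∅ then w i else 0 := by
  have hD := rate_pos hw C i
  -- the balance equation integrates this derivative over `(0, ∞)`: each factor of the product
  -- satisfies `(1 - exp (-w t))' = w (1 - (1 - exp (-w t)))`
  have hderiv : ∀ t, HasDerivAt (clockIntegrand w A C i)
      (∑ a ∈ A, w a * clockIntegrand w (A.erase a) C i t
        - (∑ a ∈ A, w a + w i + ∑ c ∈ C, w c) * clockIntegrand w A C i t) t := by
    intro t
    have h1 : HasDerivAt (fun t => Real.exp (-(w i + ∑ c ∈ C, w c) * t))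
        (Real.exp (-(w i + ∑ c ∈ C, w c) * t) * (-(w i + ∑ c ∈ C, w c))) t := by
      simpa using ((hasDerivAt_id t).const_mul (-(w i + ∑ c ∈ C, w c))).exp
    have h2 : ∀ a ∈ A, HasDerivAt (fun t => 1 - Real.exp (-w a * t))
        (w a * Real.exp (-w a * t)) t := by
      intro a _
      have := (((hasDerivAt_id t).const_mul (-w a)).exp).const_sub 1
      convert! this using 1
      simp; ring
    have h3 := HasDerivAt.fun_finsetProd h2
    refine ((h1.const_mul (w i)).mul h3).congr_deriv ?_
    have h4 : ∀ a ∈ A, (∏ j ∈ A.erase a, (1 - Real.exp (-w j * t))) •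
        (w a * Real.exp (-w a * t)) = w a * ((∏ j ∈ A.erase a, (1 - Real.exp (-w j * t))) -
          ∏ j ∈ A, (1 - Real.exp (-w j * t))) := by
      intro a ha
      rw [← Finset.mul_prod_erase A _ ha, smul_eq_mul]; ring
    rw [Finset.sum_congr rfl h4]
    simp only [clockIntegrand, mul_sub, Finset.sum_sub_distrib, Finset.mul_sum, ← Finset.sum_mul]
    have h5 : ∀ a, w a * (w i * Real.exp (-(w i + ∑ c ∈ C, w c) * t) *
        ∏ a ∈ A.erase a, (1 - Real.exp (-w a * t))) = w i *
        Real.exp (-(w i + ∑ c ∈ C, w c) * t) *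
        (w a * ∏ a ∈ A.erase a, (1 - Real.exp (-w a * t))) := fun a => by ring
    simp only [h5]
    ring
  have hint : IntegrableOn (fun t => ∑ a ∈ A, w a * clockIntegrand w (A.erase a) C i t
        - (∑ a ∈ A, w a + w i + ∑ c ∈ C, w c) * clockIntegrand w A C i t) (Ioi 0) :=
    (integrable_finsetSum _ fun a _ => (integrableOn_clockIntegrand hw _ C i).const_mul _).sub
      ((integrableOn_clockIntegrand hw A C i).const_mul _)
  have hlim : Tendsto (clockIntegrand w A C i) atTop (𝓝 0) := by
    have hexp : Tendsto (fun t => w i * Real.exp (-(w i + ∑ c ∈ C, w c) * t)) atTop (𝓝 0) := by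
      rw [← mul_zero (w i)]
      refine Tendsto.const_mul _ (Real.tendsto_exp_atBot.comp ?_)
      exact tendsto_id.const_mul_atTop_of_neg (by linarith)
    refine squeeze_zero' ?_ ?_ hexp
    · filter_upwards [eventually_ge_atTop 0] with t ht using clockIntegrand_nonneg hw A C i ht
    · filter_upwards [eventually_ge_atTop 0] with t ht
      exact mul_le_of_le_one_right (mul_nonneg (hw i).le (Real.exp_pos _).le)
        (prod_one_sub_exp_mem_Icc hw A ht).2
  have hFTC := integral_Ioi_of_hasDerivAt_of_tendsto' (a := 0) (fun t _ => hderiv t) hint hlim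
  rw [integral_sub (integrable_finsetSum _ fun a _ =>
      (integrableOn_clockIntegrand hw _ C i).const_mul _)
      ((integrableOn_clockIntegrand hw A C i).const_mul _),
    integral_finsetSum _ fun a _ => (integrableOn_clockIntegrand hw _ C i).const_mul _] at hFTC
  simp only [integral_const_mul] at hFTC
  have h0 : clockIntegrand w A C i 0 = if A = ∅ then w i else 0 := by
    split_ifs with h
    · simp [clockIntegrand, h]
    · obtain ⟨a, ha⟩ := Finset.nonempty_iff_ne_empty.2 h
      rw [clockIntegrand, Finset.prod_eq_zero ha (by simp), mul_zero]
  rw [h0] at hFTC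
  linarith

/-- Under a stationary distribution of the Move-to-Front chain, the items are ordered as
independent exponential times with rates `w`. -/
lemma separationWeight_eq_integral (hw : ∀ j, 0 < w j) {π : Equiv.Perm (Fin n) → ℝ}
    (h : IsMtfStationary (requestProb w) π) {C : Finset (Fin n)} {i : Fin n} (hiC : i ∉ C)
    (A : Finset (Fin n)) (hiA : i ∉ A) (hAC : Disjoint A C) :
    separationWeight π A C i = ∫ t in Ioi 0, clockIntegrand w A C i t := by
  have hW : 0 < ∑ j, w j := Finset.sum_pos (fun j _ => hw j) ⟨i, Finset.mem_univ i⟩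
  have hp : ∑ b, requestProb w b = 1 := by
    simp only [requestProb, ← Finset.sum_div]; exact div_self hW.ne'
  induction A using Finset.strongInduction with
  | H A ih =>
    have h1 := separationWeight_balance h hp hiA hiC hAC
    have h2 := integral_clockIntegrand_balance hw A C i
    have h3 : ∀ a ∈ A, requestProb w a * separationWeight π (A.erase a) C i =
        requestProb w a * ∫ t in Ioi 0, clockIntegrand w (A.erase a) C i t := fun a ha => by
      rw [ih _ (Finset.erase_ssubset ha) (fun hh => hiA (Finset.mem_of_mem_erase hh))
        (hAC.mono_left (Finset.erase_subset _ _))]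
    rw [Finset.sum_congr rfl h3] at h1
    have h4 : (∑ a ∈ A, w a + w i + ∑ c ∈ C, w c) * separationWeight π A C i =
      ∑ a ∈ A, w a * (∫ t in Ioi 0, clockIntegrand w (A.erase a) C i t) +
        if A = ∅ then w i else 0 := by
      have hr : ∀ b, requestProb w b = (∑ j, w j)⁻¹ * w b := fun b => by
        rw [requestProb, div_eq_inv_mul]
      simp only [hr, mul_assoc, ← Finset.mul_sum, ← mul_add] at h1
      refine mul_left_cancel₀ (inv_ne_zero hW.ne') (h1.trans ?_)
      split_ifs <;> simp [mul_add]
    have hpos : 0 < ∑ a ∈ A, w a + w i + ∑ c ∈ C, w c := by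
      have := rate_pos hw C i
      have := Finset.sum_nonneg fun a (_ : a ∈ A) => (hw a).le
      linarith
    exact mul_left_cancel₀ hpos.ne' (h4.trans h2.symm)

end clock

/-- The stationary law of the search cost of item `i`, summed over the possible sets `A` of
predecessors of `i`. -/
lemma sum_stationary_itemSearchCost_eq {n : ℕ} {w : Fin n → ℝ} (hw : ∀ j, 0 < w j)
    {π : Equiv.Perm (Fin n) → ℝ} (h : IsMtfStationary (requestProb w) π) (i : Fin n) (j : ℕ) :
    (∑ σ with itemSearchCost σ i = j, π σ) =
      ∑ A ∈ (Finset.univ.erase i).powersetCard j,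
        ∫ t in Ioi 0, clockIntegrand w A (insert i A)ᶜ i t := by
  have key : ∀ A ∈ (Finset.univ.erase i).powersetCard j,
      ∫ t in Ioi 0, clockIntegrand w A (insert i A)ᶜ i t =
        ∑ σ with (Finset.univ.filter fun j => σ j < σ i) = A, π σ := by
    intro A hA
    have hiA : i ∉ A := fun hh => by
      simpa using (Finset.mem_powersetCard.1 hA).1 hh
    rw [← separationWeight_eq_integral hw h (by simp) A hiA
      (disjoint_compl_right.mono_left (by simp)), separationWeight, Finset.sum_filter]
    refine Finset.sum_congr rfl fun σ _ => ?_
    have : Separates A (insert i A)ᶜ i σ ↔ (Finset.univ.filter fun j => σ j < σ i) = A := by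
      constructor
      · rintro ⟨h1, h2⟩
        ext a
        simp only [Finset.mem_filter, Finset.mem_univ, true_and]
        refine ⟨fun ha => ?_, h1 a⟩
        by_contra hn
        have hai : a ≠ i := fun e => by simp [e] at ha
        exact absurd (h2 a (by simp [hai, hn])) (not_lt.2 ha.le)
      · rintro rfl
        refine ⟨by simp, fun c hc => ?_⟩
        simp only [Finset.mem_compl, Finset.mem_insert, Finset.mem_filter, Finset.mem_univ,
          true_and, not_or, not_lt] at hc
        exact lt_of_le_of_ne hc.2 fun e => hc.1 (σ.injective e).symm
    simp only [this, mul_ite, mul_one, mul_zero]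
  rw [Finset.sum_congr rfl key, ← Finset.sum_fiberwise_of_maps_to
    (g := fun σ : Equiv.Perm (Fin n) => Finset.univ.filter fun j => σ j < σ i)
    (t := (Finset.univ.erase i).powersetCard j)]
  · refine Finset.sum_congr rfl fun A hA => Finset.sum_congr ?_ fun _ _ => rfl
    ext σ
    simp only [Finset.mem_filter, Finset.mem_univ, true_and, itemSearchCost,
      and_iff_right_iff_imp]
    exact fun e => Finset.mem_filter.2 ⟨Finset.mem_univ _, by
      rw [e]; exact (Finset.mem_powersetCard.1 hA).2⟩
  · intro σ hσ
    rw [Finset.mem_powersetCard]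
    refine ⟨fun a ha => ?_, (Finset.mem_filter.1 hσ).2⟩
    have : σ a < σ i := by simpa using ha
    simpa using fun e : a = i => by simp [e] at this

/-! ### The law of the search cost for independent weights -/

section law
variable {Ω : Type*} [MeasurableSpace Ω] {P : Measure Ω} {n : ℕ}
  {w : Ω → Fin n → ℝ} {S : Ω → ℕ}

lemma IsStationarySearchCost.measurable (h : IsStationarySearchCost P w S) : Measurable S := by
  obtain ⟨σ, R, hσ, hR, -, hS⟩ := h
  refine measurable_to_countable' fun j => ?_
  have : S ⁻¹' {j} = ⋃ (τ : Equiv.Perm (Fin n)) (i : Fin n) (_ : itemSearchCost τ i = j),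
      {ω | σ ω = τ} ∩ R ⁻¹' {i} := by
    ext ω
    simp [hS]
  rw [this]
  exact .iUnion fun τ => .iUnion fun i => .iUnion fun _ =>
    (hσ τ).inter (hR (measurableSet_singleton i))

variable [IsProbabilityMeasure P]

/-- The law of the search cost, averaged over the weights and summed over the requested item `i` and
the set `A` of its predecessors. -/
lemma IsStationarySearchCost.measure_eq_lintegral (hw : Measurable w)
    (hpos : ∀ᵐ ω ∂P, ∀ k, 0 < w ω k) (h : IsStationarySearchCost P w S) (j : ℕ) :
    P {ω | S ω = j} = ∫⁻ ω, ∑ i, ∑ A ∈ (Finset.univ.erase i).powersetCard j,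
      ENNReal.ofReal (requestProb (w ω) i) *
        ENNReal.ofReal (∫ t in Ioi 0, clockIntegrand (w ω) A (insert i A)ᶜ i t) ∂P := by
  obtain ⟨σ, R, hσ, hR, ⟨π, hπ, hcond⟩, hS⟩ := h
  have hm : MeasurableSpace.comap w inferInstance ≤ (inferInstance : MeasurableSpace Ω) :=
    hw.comap_le
  have hmeas : ∀ τ i, MeasurableSet {ω | σ ω = τ ∧ R ω = i} := fun τ i =>
    (hσ τ).inter (hR (measurableSet_singleton i))
  have hint : ∀ τ i, Integrable (fun ω => π ω τ * requestProb (w ω) i) P := fun τ i =>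
    integrable_condExp.congr (hcond τ i)
  have hp0 : ∀ᵐ ω ∂P, ∀ i, 0 ≤ requestProb (w ω) i := hpos.mono fun ω hω i =>
    div_nonneg (hω i).le (Finset.sum_nonneg fun k _ => (hω k).le)
  have hprob : ∀ τ i, P {ω | σ ω = τ ∧ R ω = i} =
      ∫⁻ ω, ENNReal.ofReal (π ω τ * requestProb (w ω) i) ∂P := by
    intro τ i
    rw [← ofReal_integral_eq_lintegral_ofReal (hint τ i) ?_, ← integral_congr_ae (hcond τ i),
      integral_condExp hm, integral_indicator_const _ (hmeas τ i)]
    · simp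
    · filter_upwards [hπ, hp0] with ω h1 h2 using mul_nonneg (h1.1.1 τ) (h2 i)
  have hset : {ω | S ω = j} = ⋃ x ∈ (Finset.univ : Finset (Fin n)).sigma
      (fun i => Finset.univ.filter fun τ : Equiv.Perm (Fin n) => itemSearchCost τ i = j),
      {ω | σ ω = x.2 ∧ R ω = x.1} := by
    ext ω
    simp [hS]
  rw [hset, measure_biUnion_finset, Finset.sum_sigma]
  · simp only [hprob]
    have haem : ∀ i τ, AEMeasurable (fun ω => ENNReal.ofReal (π ω τ * requestProb (w ω) i)) P :=
      fun i τ => (hint τ i).aestronglyMeasurable.aemeasurable.ennreal_ofReal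
    simp only [← lintegral_finsetSum' _ fun τ _ => haem _ τ]
    rw [← lintegral_finsetSum' _ fun i _ => Finset.aemeasurable_fun_sum _ fun τ _ => haem i τ]
    refine lintegral_congr_ae ?_
    filter_upwards [hπ, hp0, hpos] with ω h1 h2 h3
    refine Finset.sum_congr rfl fun i _ => ?_
    rw [← ENNReal.ofReal_sum_of_nonneg fun τ _ => mul_nonneg (h1.1.1 τ) (h2 i),
      ← Finset.sum_mul, sum_stationary_itemSearchCost_eq h3 h1, mul_comm,
      ENNReal.ofReal_mul (h2 i), ENNReal.ofReal_sum_of_nonneg, Finset.mul_sum]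
    exact fun A _ => setIntegral_nonneg measurableSet_Ioi fun t ht =>
      clockIntegrand_nonneg h3 _ _ _ (le_of_lt ht)
  · intro x _ y _ hxy
    refine Set.disjoint_left.2 fun ω hx hy => hxy ?_
    exact Sigma.ext (hx.2.symm.trans hy.2) (heq_of_eq (hx.1.symm.trans hy.1))
  · exact fun x _ => hmeas _ _

/-- The factor of the item `k` in the joint density at `(x, t)` of the request of item `i` and the
event that the predecessors of `i` are the items of `A`. -/
noncomputable def clockFactor {n : ℕ} (A : Finset (Fin n)) (i k : Fin n) (z : ℝ × ℝ) (v : ℝ) : ℝ :=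
  (if k = i then v ^ 2 else 1) * Real.exp (-(z.1 * v)) *
    if k ∈ A then 1 - Real.exp (-(z.2 * v)) else Real.exp (-(z.2 * v))

lemma measurable_clockFactor (A : Finset (Fin n)) (i k : Fin n) :
    Measurable fun q : (ℝ × ℝ) × ℝ => clockFactor A i k q.1 q.2 := by
  unfold clockFactor
  split_ifs <;> fun_prop

lemma clockFactor_nonneg (A : Finset (Fin n)) (i k : Fin n) {z : ℝ × ℝ} {v : ℝ} (hz : 0 ≤ z.2)
    (hv : 0 ≤ v) : 0 ≤ clockFactor A i k z v := by
  have : Real.exp (-(z.2 * v)) ≤ 1 := by rw [Real.exp_le_one_iff]; nlinarith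
  unfold clockFactor
  refine mul_nonneg (mul_nonneg (by split_ifs <;> positivity) (Real.exp_pos _).le) ?_
  split_ifs <;> [linarith; positivity]

lemma volume_restrict_quadrant : (volume : Measure (ℝ × ℝ)).restrict quadrant =
    (volume.restrict (Ioi 0)).prod (volume.restrict (Ioi 0)) := by
  rw [quadrant, Measure.volume_eq_prod, Measure.prod_restrict]

lemma measurableSet_quadrant : MeasurableSet quadrant := measurableSet_Ioi.prod measurableSet_Ioi

/-- The normalization by the total weight is removed by writing `p i` as the integral of
`w i * exp (-(∑ j, w j) x)` over `x > 0`; the integrand then factorizes over the items. -/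
lemma ofReal_requestProb_mul_eq_lintegral {w : Fin n → ℝ} (hw : ∀ k, 0 < w k) {i : Fin n}
    {A : Finset (Fin n)} (hiA : i ∉ A) :
    ENNReal.ofReal (requestProb w i) *
        ENNReal.ofReal (∫ t in Ioi 0, clockIntegrand w A (insert i A)ᶜ i t) =
      ∫⁻ z in quadrant, ∏ k, ENNReal.ofReal (clockFactor A i k z (w k)) := by
  have hW : 0 < ∑ j, w j := Finset.sum_pos (fun j _ => hw j) ⟨i, Finset.mem_univ i⟩
  have h1 : requestProb w i = ∫ x in Ioi 0, w i * Real.exp (-(∑ j, w j) * x) := by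
    rw [integral_const_mul, integral_exp_mul_Ioi (neg_lt_zero.2 hW), requestProb]
    simp; field_simp
  rw [h1, ofReal_integral_eq_lintegral_ofReal
      ((integrableOn_exp_mul_Ioi (neg_lt_zero.2 hW) 0).const_mul (w i))
      (Eventually.of_forall fun x => mul_nonneg (hw i).le (Real.exp_pos _).le),
    ofReal_integral_eq_lintegral_ofReal (integrableOn_clockIntegrand hw _ _ _)
      ((ae_restrict_mem measurableSet_Ioi).mono fun t ht =>
        clockIntegrand_nonneg hw _ _ _ (le_of_lt ht)),
    ← lintegral_prod_mul (by fun_prop)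
      (continuous_clockIntegrand _ _ _ _).measurable.ennreal_ofReal.aemeasurable,
    ← volume_restrict_quadrant]
  refine setLIntegral_congr_fun measurableSet_quadrant fun z hz => ?_
  have hz2 : 0 ≤ z.2 := le_of_lt hz.2
  rw [← ENNReal.ofReal_mul (mul_nonneg (hw i).le (Real.exp_pos _).le),
    ← ENNReal.ofReal_prod_of_nonneg fun k _ => clockFactor_nonneg A i k hz2 (hw k).le]
  congr 1
  have h2 : w i + ∑ c ∈ (insert i A)ᶜ, w c = ∑ c ∈ Aᶜ, w c := by
    rw [Finset.compl_insert, Finset.add_sum_erase _ _ (by simpa using hiA)]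
  have h3 : (∏ k, if k ∈ A then 1 - Real.exp (-(z.2 * w k)) else Real.exp (-(z.2 * w k))) =
      (∏ k ∈ A, (1 - Real.exp (-(z.2 * w k)))) * ∏ k ∈ Aᶜ, Real.exp (-(z.2 * w k)) := by
    rw [Finset.prod_ite]
    congr 2 <;> ext <;> simp
  simp only [clockFactor, Finset.prod_mul_distrib, clockIntegrand, h2, h3,
    Finset.prod_ite_eq', Finset.mem_univ, if_true, ← Real.exp_sum]
  have h4 : ∀ k, -w k * z.2 = -(z.2 * w k) := fun k => by ring
  have h5 : -(∑ j, w j) * z.1 = ∑ k, -(z.1 * w k) := by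
    rw [Finset.sum_neg_distrib, ← Finset.mul_sum]; ring
  have h6 : -(∑ c ∈ Aᶜ, w c) * z.2 = ∑ k ∈ Aᶜ, -(z.2 * w k) := by
    rw [Finset.sum_neg_distrib, ← Finset.mul_sum]; ring
  simp only [h4, h5, h6]
  ring

variable {φ φ₂ : ℝ → ℝ}

lemma lintegral_clockFactor {X : Ω → ℝ} (hX : Measurable X) (hX0 : ∀ᵐ ω ∂P, 0 ≤ X ω)
    (hφ : ∀ s, 0 < s → ∫ ω, Real.exp (-(s * X ω)) ∂P = φ s)
    (hi₂ : ∀ s, 0 < s → Integrable (fun ω => X ω ^ 2 * Real.exp (-(s * X ω))) P)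
    (hφ₂ : ∀ s, 0 < s → ∫ ω, X ω ^ 2 * Real.exp (-(s * X ω)) ∂P = φ₂ s)
    {A : Finset (Fin n)} {i k : Fin n} (hiA : i ∉ A) {z : ℝ × ℝ} (hz : z ∈ quadrant) :
    ∫⁻ ω, ENNReal.ofReal (clockFactor A i k z (X ω)) ∂P =
      ENNReal.ofReal (if k = i then φ₂ (z.1 + z.2) else
        if k ∈ A then φ z.1 - φ (z.1 + z.2) else φ (z.1 + z.2)) := by
  have hz1 : 0 < z.1 := hz.1
  have hz2 : 0 < z.2 := hz.2
  have hi : ∀ s, 0 < s → Integrable (fun ω => Real.exp (-(s * X ω))) P := by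
    intro s hs
    refine Integrable.of_bound (by fun_prop) 1 (hX0.mono fun ω hω => ?_)
    rw [Real.norm_eq_abs, Real.abs_exp, Real.exp_le_one_iff]
    nlinarith
  have hadd : ∀ v, Real.exp (-(z.1 * v)) * Real.exp (-(z.2 * v)) =
      Real.exp (-((z.1 + z.2) * v)) := fun v => by rw [← Real.exp_add]; ring_nf
  have hnn : 0 ≤ᵐ[P] fun ω => clockFactor A i k z (X ω) :=
    hX0.mono fun ω hω => clockFactor_nonneg A i k hz2.le hω
  by_cases h1 : k = i
  · have e : ∀ v, clockFactor A i k z v = v ^ 2 * Real.exp (-((z.1 + z.2) * v)) := fun v => by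
      rw [clockFactor, if_pos h1, if_neg (h1 ▸ hiA), mul_assoc, hadd]
    simp only [e] at hnn ⊢
    rw [← ofReal_integral_eq_lintegral_ofReal (hi₂ _ (by positivity)) hnn,
      hφ₂ _ (by positivity), if_pos h1]
  by_cases h2 : k ∈ A
  · have e : ∀ v, clockFactor A i k z v =
        Real.exp (-(z.1 * v)) - Real.exp (-((z.1 + z.2) * v)) := fun v => by
      rw [clockFactor, if_neg h1, if_pos h2, one_mul, mul_sub, hadd, mul_one]
    simp only [e] at hnn ⊢
    have hsub : Integrable (fun ω => Real.exp (-(z.1 * X ω)) - Real.exp (-((z.1 + z.2) * X ω))) P :=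
      (hi _ hz1).sub (hi _ (by positivity))
    rw [← ofReal_integral_eq_lintegral_ofReal hsub hnn,
      integral_sub (hi _ hz1) (hi _ (by positivity)), hφ _ hz1, hφ _ (by positivity), if_neg h1,
      if_pos h2]
  · have e : ∀ v, clockFactor A i k z v = Real.exp (-((z.1 + z.2) * v)) := fun v => by
      rw [clockFactor, if_neg h1, if_neg h2, one_mul, hadd]
    simp only [e] at hnn ⊢
    rw [← ofReal_integral_eq_lintegral_ofReal (hi _ (by positivity)) hnn,
      hφ _ (by positivity), if_neg h1, if_neg h2]

/-- The law of the stationary search cost for independent identically distributed weights with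
Laplace transform `φ` and `φ₂ = φ''`. -/
lemma IsStationarySearchCost.measure_eq (hw : ∀ k, Measurable fun ω => w ω k)
    (hind : iIndepFun (fun k ω => w ω k) P) (hpos : ∀ᵐ ω ∂P, ∀ k, 0 < w ω k)
    (h : IsStationarySearchCost P w S)
    (hφ : ∀ k s, 0 < s → ∫ ω, Real.exp (-(s * w ω k)) ∂P = φ s)
    (hi₂ : ∀ k s, 0 < s → Integrable (fun ω => w ω k ^ 2 * Real.exp (-(s * w ω k))) P)
    (hφ₂ : ∀ k s, 0 < s → ∫ ω, w ω k ^ 2 * Real.exp (-(s * w ω k)) ∂P = φ₂ s) (j : ℕ) :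
    P {ω | S ω = j} = ∫⁻ z in quadrant, n * (n - 1).choose j *
      (ENNReal.ofReal (φ₂ (z.1 + z.2)) * ENNReal.ofReal (φ z.1 - φ (z.1 + z.2)) ^ j *
        ENNReal.ofReal (φ (z.1 + z.2)) ^ (n - 1 - j)) := by
  have hwm : Measurable w := measurable_pi_iff.2 hw
  have hmF : ∀ (A : Finset (Fin n)) i, Measurable fun q : Ω × (ℝ × ℝ) =>
      ∏ k, ENNReal.ofReal (clockFactor A i k q.2 (w q.1 k)) := fun A i =>
    Finset.measurable_fun_prod _ fun k _ => ((measurable_clockFactor A i k).comp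
      (measurable_snd.prodMk ((hw k).comp measurable_fst))).ennreal_ofReal
  have hterm : ∀ i, ∀ A ∈ (Finset.univ.erase i).powersetCard j,
      ∫⁻ ω, ∫⁻ z in quadrant, (∏ k, ENNReal.ofReal (clockFactor A i k z (w ω k))) ∂volume ∂P =
      ∫⁻ z in quadrant, (ENNReal.ofReal (φ₂ (z.1 + z.2)) *
        ENNReal.ofReal (φ z.1 - φ (z.1 + z.2)) ^ j *
        ENNReal.ofReal (φ (z.1 + z.2)) ^ (n - 1 - j)) := by
    intro i A hA
    have hiA : i ∉ A := fun hh => by simpa using (Finset.mem_powersetCard.1 hA).1 hh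
    rw [lintegral_lintegral_swap (hmF A i).aemeasurable]
    refine setLIntegral_congr_fun measurableSet_quadrant fun z hz => ?_
    have hgm : ∀ k, Measurable fun v : ℝ => ENNReal.ofReal (clockFactor A i k z v) := fun k =>
      ((measurable_clockFactor A i k).comp (measurable_const.prodMk measurable_id)).ennreal_ofReal
    have := lintegral_prod_eq_prod_lintegral_of_indepFun Finset.univ
      (fun k ω => ENNReal.ofReal (clockFactor A i k z (w ω k)))
      (hind.comp (fun k v => ENNReal.ofReal (clockFactor A i k z v)) hgm)
      (fun k => (hgm k).comp (hw k))
    rw [this, Finset.prod_congr rfl fun k _ => lintegral_clockFactor (hw k)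
      (hpos.mono fun ω hω => (hω k).le) (hφ k) (hi₂ k) (hφ₂ k) hiA hz,
      ← Finset.mul_prod_erase _ _ (Finset.mem_univ i), if_pos rfl, mul_assoc]
    congr 1
    have e : ∀ k ∈ Finset.univ.erase i, ENNReal.ofReal (if k = i then φ₂ (z.1 + z.2) else
        if k ∈ A then φ z.1 - φ (z.1 + z.2) else φ (z.1 + z.2)) = if k ∈ A then
        ENNReal.ofReal (φ z.1 - φ (z.1 + z.2)) else ENNReal.ofReal (φ (z.1 + z.2)) := by
      intro k hk
      rw [if_neg (Finset.ne_of_mem_erase hk)]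
      split_ifs <;> rfl
    obtain ⟨hAs, hAc⟩ := Finset.mem_powersetCard.1 hA
    rw [Finset.prod_congr rfl e, Finset.prod_ite, Finset.prod_const, Finset.prod_const,
      Finset.filter_mem_eq_inter, Finset.inter_eq_right.2 hAs, hAc, Finset.filter_notMem_eq_sdiff,
      Finset.card_sdiff_of_subset hAs, hAc, Finset.card_erase_of_mem (Finset.mem_univ i),
      Finset.card_univ, Fintype.card_fin]
  rw [h.measure_eq_lintegral hwm hpos]
  have hstep : ∫⁻ ω, ∑ i, ∑ A ∈ (Finset.univ.erase i).powersetCard j,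
      ENNReal.ofReal (requestProb (w ω) i) *
        ENNReal.ofReal (∫ t in Ioi 0, clockIntegrand (w ω) A (insert i A)ᶜ i t) ∂P =
      ∫⁻ ω, ∑ i, ∑ A ∈ (Finset.univ.erase i).powersetCard j,
        ∫⁻ z in quadrant, (∏ k, ENNReal.ofReal (clockFactor A i k z (w ω k))) ∂volume ∂P := by
    refine lintegral_congr_ae (hpos.mono fun ω hω => ?_)
    refine Finset.sum_congr rfl fun i _ => Finset.sum_congr rfl fun A hA => ?_
    exact ofReal_requestProb_mul_eq_lintegral hω fun hh => by
      simpa using (Finset.mem_powersetCard.1 hA).1 hh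
  have hmG : ∀ i (A : Finset (Fin n)), Measurable fun ω =>
      ∫⁻ z in quadrant, ∏ k, ENNReal.ofReal (clockFactor A i k z (w ω k)) := fun i A =>
    (hmF A i).lintegral_prod_right'
  rw [hstep, lintegral_finsetSum _ fun i _ => Finset.measurable_fun_sum _ fun A _ => hmG i A]
  simp only [lintegral_finsetSum _ fun A _ => hmG _ A]
  rw [Finset.sum_congr rfl fun i _ => Finset.sum_congr rfl (hterm i),
    lintegral_const_mul' _ _ (by finiteness)]
  simp [Finset.card_erase_of_mem, mul_assoc]

end law

/-! ### Analysis of the limiting density -/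

/-- The properties of the Laplace exponent of a driftless subordinator of infinite activity on which
the limit theorems rest. The limit of `ψ'` at infinity is the drift, that of `ψ` is the total mass
of the Lévy measure. -/
structure IsDriftlessExponent (ψ : ℝ → ℝ) : Prop where
  measurable : Measurable ψ
  contDiffOn : ContDiffOn ℝ 2 ψ (Ioi 0)
  deriv_nonneg : ∀ s, 0 < s → 0 ≤ deriv ψ s
  deriv_deriv_nonpos : ∀ s, 0 < s → deriv (deriv ψ) s ≤ 0
  map_zero : ψ 0 = 0
  continuousWithinAt_zero : ContinuousWithinAt ψ (Ici 0) 0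
  tendsto_atTop : Tendsto ψ atTop atTop
  tendsto_deriv : Tendsto (deriv ψ) atTop (𝓝 0)

lemma lintegral_Ioc_eq_of_hasDerivAt {H h : ℝ → ℝ} {y : ℝ} (hy : 0 ≤ y)
    (hH : ∀ u, 0 ≤ u → HasDerivAt H (h u) u) (hH0 : H 0 = 0) (hh : ∀ u, 0 ≤ u → 0 ≤ h u) :
    ∫⁻ u in Ioc 0 y, ENNReal.ofReal (h u) = ENNReal.ofReal (H y) := by
  have hint : IntegrableOn h (Ioc 0 y) := intervalIntegral.integrableOn_deriv_of_nonneg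
    (fun u hu => (hH u hu.1).continuousAt.continuousWithinAt)
    (fun u hu => hH u hu.1.le) fun u hu => hh u hu.1.le
  rw [← ofReal_integral_eq_lintegral_ofReal hint
    ((ae_restrict_mem measurableSet_Ioc).mono fun u hu => hh u hu.1.le),
    ← intervalIntegral.integral_of_le hy, intervalIntegral.integral_eq_sub_of_hasDerivAt
    (fun u hu => hH u (by rw [uIcc_of_le hy] at hu; exact hu.1))
    ((intervalIntegrable_iff_integrableOn_Ioc_of_le hy).2 hint), hH0, sub_zero]

lemma lintegral_Ioi_eq_of_hasDerivAt {G g : ℝ → ℝ} {a : ℝ}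
    (hG : ∀ y, a ≤ y → HasDerivAt G (-g y) y) (hg : ∀ y, a ≤ y → 0 ≤ g y)
    (hlim : Tendsto G atTop (𝓝 0)) :
    ∫⁻ y in Ioi a, ENNReal.ofReal (g y) = ENNReal.ofReal (G a) := by
  have hneg : ∀ y ∈ Ioi a, -g y ≤ 0 := fun y hy => neg_nonpos.2 (hg y (le_of_lt hy))
  have hint := integrableOn_Ioi_deriv_of_nonpos' (fun y hy => hG y hy) hneg hlim
  have hval := integral_Ioi_of_hasDerivAt_of_nonpos' (fun y hy => hG y hy) hneg hlim
  have hint' : IntegrableOn g (Ioi a) := by simpa using hint.neg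
  rw [integral_neg] at hval
  rw [← ofReal_integral_eq_lintegral_ofReal hint'
    ((ae_restrict_mem measurableSet_Ioi).mono fun u hu => hg u (le_of_lt hu))]
  congr 1
  linarith

/-- Integration by parts for nonnegative functions on a half-line, without integrability
assumptions: both sides are the integral of `g y * h u` over `0 < u ≤ y`. -/
lemma lintegral_mul_ofReal_primitive {G g H h : ℝ → ℝ} (hgm : Measurable g) (hhm : Measurable h)
    (hH : ∀ u, 0 ≤ u → HasDerivAt H (h u) u) (hH0 : H 0 = 0) (hh : ∀ u, 0 ≤ u → 0 ≤ h u)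
    (hG : ∀ y, 0 ≤ y → HasDerivAt G (-g y) y) (hg : ∀ y, 0 ≤ y → 0 ≤ g y)
    (hlim : Tendsto G atTop (𝓝 0)) :
    ∫⁻ y in Ioi 0, ENNReal.ofReal (g y) * ENNReal.ofReal (H y) =
      ∫⁻ u in Ioi 0, ENNReal.ofReal (h u) * ENNReal.ofReal (G u) := by
  have h1 : ∀ y ∈ Ioi (0 : ℝ), ENNReal.ofReal (g y) * ENNReal.ofReal (H y) =
      ∫⁻ u in Ioi 0, {q : ℝ × ℝ | q.2 ≤ q.1}.indicator
        (fun q => ENNReal.ofReal (g q.1) * ENNReal.ofReal (h q.2)) (y, u) := by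
    intro y hy
    rw [← lintegral_Ioc_eq_of_hasDerivAt (le_of_lt hy) hH hH0 hh,
      ← lintegral_const_mul _ hhm.ennreal_ofReal, ← Ioi_inter_Iic, inter_comm,
      ← Measure.restrict_restrict measurableSet_Iic, ← lintegral_indicator measurableSet_Iic]
    rfl
  have h2 : ∀ u ∈ Ioi (0 : ℝ), ENNReal.ofReal (h u) * ENNReal.ofReal (G u) =
      ∫⁻ y in Ioi 0, {q : ℝ × ℝ | q.2 ≤ q.1}.indicator
        (fun q => ENNReal.ofReal (g q.1) * ENNReal.ofReal (h q.2)) (y, u) := by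
    intro u hu
    have hu' : 0 < u := hu
    rw [← lintegral_Ioi_eq_of_hasDerivAt (fun y hy => hG y (hu'.le.trans hy))
      (fun y hy => hg y (hu'.le.trans hy)) hlim, mul_comm,
      ← lintegral_mul_const _ hgm.ennreal_ofReal, setLIntegral_congr Ioi_ae_eq_Ici,
      ← inter_eq_left.2 (Ici_subset_Ioi.2 hu'),
      ← Measure.restrict_restrict measurableSet_Ici, ← lintegral_indicator measurableSet_Ici]
    rfl
  rw [setLIntegral_congr_fun measurableSet_Ioi h1, setLIntegral_congr_fun measurableSet_Ioi h2,
    lintegral_lintegral_swap]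
  refine Measurable.aemeasurable (Measurable.indicator ?_ (measurableSet_le measurable_snd
    measurable_fst))
  fun_prop

/-- `(1 - exp (-ε r)) / ε`, extended by its limit `r` at `ε = 0`. For `ε = 1/n` it is `n` times the
probability `1 - exp (-r / n)`. -/
noncomputable def tiltedRate (ε r : ℝ) : ℝ :=
  if ε = 0 then r else (1 - Real.exp (-ε * r)) / ε

lemma tiltedRate_zero_right (ε : ℝ) : tiltedRate ε 0 = 0 := by
  simp [tiltedRate]

lemma tiltedRate_zero_left (r : ℝ) : tiltedRate 0 r = r := if_pos rfl

lemma hasDerivAt_tiltedRate (ε r : ℝ) : HasDerivAt (tiltedRate ε) (Real.exp (-ε * r)) r := by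
  by_cases h : ε = 0
  · subst h
    have : tiltedRate 0 = id := funext tiltedRate_zero_left
    rw [this]
    simpa using hasDerivAt_id r
  · have : tiltedRate ε = fun r => (1 - Real.exp (-ε * r)) / ε := funext fun r => if_neg h
    rw [this]
    convert! ((((hasDerivAt_id r).const_mul (-ε)).exp).const_sub 1).div_const ε using 1
    simp only [id]
    field_simp

lemma measurable_tiltedRate (ε : ℝ) : Measurable (tiltedRate ε) :=
  (continuous_iff_continuousAt.2 fun r => (hasDerivAt_tiltedRate ε r).continuousAt).measurable

lemma tiltedRate_nonneg {ε r : ℝ} (hε : 0 ≤ ε) (hr : 0 ≤ r) : 0 ≤ tiltedRate ε r := by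
  unfold tiltedRate
  split_ifs
  · exact hr
  · refine div_nonneg (sub_nonneg.2 (Real.exp_le_one_iff.2 ?_)) hε
    nlinarith

lemma tiltedRate_le {ε r : ℝ} (hε : 0 ≤ ε) : tiltedRate ε r ≤ r := by
  unfold tiltedRate
  split_ifs with h
  · exact le_rfl
  · rw [div_le_iff₀ (lt_of_le_of_ne hε (Ne.symm h))]
    linarith [Real.add_one_le_exp (-ε * r)]

/-- As a function of `ε`, the tilted rate is the slope at `0` of `ε ↦ 1 - exp (-ε r)`. -/
lemma tendsto_tiltedRate (r : ℝ) : Tendsto (fun ε => tiltedRate ε r) (𝓝 0) (𝓝 r) := by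
  have h : HasDerivAt (fun ε : ℝ => 1 - Real.exp (-ε * r)) r 0 := by
    convert! (((hasDerivAt_id (0 : ℝ)).neg.mul_const r).exp).const_sub 1 using 1
    simp
  have h2 := hasDerivAt_iff_tendsto_slope.1 h
  rw [← nhdsNE_sup_pure, tendsto_sup]
  refine ⟨h2.congr' ?_, ?_⟩
  · filter_upwards [self_mem_nhdsWithin] with ε hε
    rw [tiltedRate, if_neg (show ε ≠ 0 from hε), slope_def_field]
    simp
  · rw [tendsto_pure_left]
    intro s hs
    rw [tiltedRate_zero_left]
    exact mem_of_mem_nhds hs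

/-- The density of the mixing variable of the binomial mixture describing the search cost of
`n = 1/ε` items; at `ε = 0` it is the mixing density of the limit. -/
noncomputable def tiltedDensity (ψ : ℝ → ℝ) (ε x y : ℝ) : ℝ :=
  (ε * deriv ψ (x + y) ^ 2 - deriv (deriv ψ) (x + y)) * Real.exp (-ψ x) *
    Real.exp (-ε * mixingRate ψ x y)

/-- The result of integrating `tiltedDensity * tiltedRate ^ l` by parts in `y`. -/
noncomputable def momentKernel (ψ : ℝ → ℝ) (ε : ℝ) (l : ℕ) (x y : ℝ) : ℝ :=
  l * (deriv ψ (x + y) ^ 2 * Real.exp (-ψ x) * Real.exp (-(2 * ε) * mixingRate ψ x y) *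
    tiltedRate ε (mixingRate ψ x y) ^ (l - 1))

lemma tiltedDensity_zero (ψ : ℝ → ℝ) (x y : ℝ) : tiltedDensity ψ 0 x y = mixingDensity ψ x y := by
  simp [tiltedDensity, mixingDensity]

lemma setLIntegral_quadrant {F : ℝ × ℝ → ℝ≥0∞} (hF : Measurable F) :
    ∫⁻ z in quadrant, F z = ∫⁻ x in Ioi 0, ∫⁻ y in Ioi 0, F (x, y) := by
  rw [volume_restrict_quadrant, lintegral_prod _ hF.aemeasurable]

namespace IsDriftlessExponent
variable {ψ : ℝ → ℝ} (h : IsDriftlessExponent ψ)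
include h

lemma hasDerivAt {s : ℝ} (hs : 0 < s) : HasDerivAt ψ (deriv ψ s) s :=
  ((h.contDiffOn.differentiableOn (by norm_num)).differentiableAt (Ioi_mem_nhds hs)).hasDerivAt

lemma hasDerivAt_deriv {s : ℝ} (hs : 0 < s) : HasDerivAt (deriv ψ) (deriv (deriv ψ) s) s :=
  ((((contDiffOn_succ_iff_deriv_of_isOpen (n := 1) isOpen_Ioi).1 h.contDiffOn).2.2.differentiableOn
    (by norm_num)).differentiableAt (Ioi_mem_nhds hs)).hasDerivAt

lemma monotoneOn : MonotoneOn ψ (Ioi 0) :=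
  monotoneOn_of_deriv_nonneg (convex_Ioi 0) h.contDiffOn.continuousOn
    ((h.contDiffOn.differentiableOn (by norm_num)).mono interior_subset)
    fun s hs => h.deriv_nonneg s (by simpa using hs)

lemma mixingRate_nonneg {x y : ℝ} (hx : 0 < x) (hy : 0 ≤ y) : 0 ≤ mixingRate ψ x y :=
  sub_nonneg.2 (h.monotoneOn hx (show 0 < x + y by linarith) (by linarith))

lemma measurable_mixingRate : Measurable fun z : ℝ × ℝ => mixingRate ψ z.1 z.2 := by
  have := h.measurable
  unfold mixingRate; fun_prop

lemma measurable_tiltedDensity (ε : ℝ) :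
    Measurable fun z : ℝ × ℝ => tiltedDensity ψ ε z.1 z.2 := by
  have h1 := h.measurable
  have h2 := measurable_deriv ψ
  have h3 := measurable_deriv (deriv ψ)
  have h4 := h.measurable_mixingRate
  unfold tiltedDensity; fun_prop

lemma measurable_momentKernel (ε : ℝ) (l : ℕ) :
    Measurable fun z : ℝ × ℝ => momentKernel ψ ε l z.1 z.2 := by
  have h1 := h.measurable
  have h2 := measurable_deriv ψ
  have h4 := h.measurable_mixingRate
  have h5 := measurable_tiltedRate ε
  unfold momentKernel; fun_prop

lemma tiltedDensity_nonneg {ε x y : ℝ} (hε : 0 ≤ ε) (hx : 0 < x) (hy : 0 ≤ y) :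
    0 ≤ tiltedDensity ψ ε x y := by
  have := h.deriv_deriv_nonpos (x + y) (by linarith)
  unfold tiltedDensity
  have : 0 ≤ ε * deriv ψ (x + y) ^ 2 - deriv (deriv ψ) (x + y) := by
    have := mul_nonneg hε (sq_nonneg (deriv ψ (x + y)))
    linarith
  positivity

lemma hasDerivAt_mixingRate {x y : ℝ} (hx : 0 < x) (hy : 0 ≤ y) :
    HasDerivAt (mixingRate ψ x) (deriv ψ (x + y)) y :=
  ((h.hasDerivAt (show 0 < x + y by linarith)).comp_const_add x y).sub_const (ψ x)

lemma hasDerivAt_deriv_mul_exp {ε x y : ℝ} (hx : 0 < x) (hy : 0 ≤ y) :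
    HasDerivAt (fun y => deriv ψ (x + y) * Real.exp (-ψ x) * Real.exp (-ε * mixingRate ψ x y))
      (-tiltedDensity ψ ε x y) y := by
  have h1 := (h.hasDerivAt_deriv (show 0 < x + y by linarith)).comp_const_add x y
  have h2 := ((h.hasDerivAt_mixingRate hx hy).const_mul (-ε)).exp
  refine ((h1.mul_const (Real.exp (-ψ x))).mul h2).congr_deriv ?_
  unfold tiltedDensity
  ring

lemma tendsto_deriv_mul_exp {ε x : ℝ} (hε : 0 ≤ ε) (hx : 0 < x) :
    Tendsto (fun y => deriv ψ (x + y) * Real.exp (-ψ x) * Real.exp (-ε * mixingRate ψ x y))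
      atTop (𝓝 0) := by
  have h1 : Tendsto (fun y => deriv ψ (x + y) * Real.exp (-ψ x)) atTop (𝓝 0) := by
    rw [← zero_mul (Real.exp (-ψ x))]
    exact (h.tendsto_deriv.comp (tendsto_atTop_add_const_left _ x tendsto_id)).mul_const _
  refine squeeze_zero' ?_ ?_ h1
  · filter_upwards [eventually_ge_atTop 0] with y hy
    have := h.deriv_nonneg (x + y) (by linarith)
    positivity
  · filter_upwards [eventually_ge_atTop 0] with y hy
    refine mul_le_of_le_one_right (mul_nonneg (h.deriv_nonneg (x + y) (by linarith))
      (Real.exp_pos _).le) (Real.exp_le_one_iff.2 ?_)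
    have := mul_nonneg hε (h.mixingRate_nonneg hx hy)
    linarith

lemma hasDerivAt_tiltedRate_pow {ε x y : ℝ} (hx : 0 < x) (hy : 0 ≤ y) (l : ℕ) :
    HasDerivAt (fun y => tiltedRate ε (mixingRate ψ x y) ^ l)
      (l * tiltedRate ε (mixingRate ψ x y) ^ (l - 1) *
        (Real.exp (-ε * mixingRate ψ x y) * deriv ψ (x + y))) y :=
  ((hasDerivAt_tiltedRate ε _).comp y (h.hasDerivAt_mixingRate hx hy)).pow l

lemma measurable_tiltedRate_pow_deriv (ε x : ℝ) (l : ℕ) :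
    Measurable fun y => l * tiltedRate ε (mixingRate ψ x y) ^ (l - 1) *
        (Real.exp (-ε * mixingRate ψ x y) * deriv ψ (x + y)) := by
  have h2 : Measurable (mixingRate ψ x) := h.measurable_mixingRate.comp measurable_prodMk_left
  have h1 := (measurable_tiltedRate ε).comp h2
  have h3 : Measurable fun y => deriv ψ (x + y) :=
    (measurable_deriv ψ).comp (measurable_const_add x)
  exact ((h1.pow_const (l - 1)).const_mul (l : ℝ)).mul ((h2.const_mul (-ε)).exp.mul h3)

/-- Here `tiltedDensity` is minus the `y`-derivative of `ψ'(x + y) * exp (-ψ x - ε r)` and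
`tiltedRate ε r` has `y`-derivative `ψ'(x + y) * exp (-ε r)`, where `r` is the mixing rate. -/
lemma lintegral_tiltedDensity_mul_pow {ε x : ℝ} (hε : 0 ≤ ε) (hx : 0 < x) {l : ℕ} (hl : 1 ≤ l) :
    ∫⁻ y in Ioi 0, ENNReal.ofReal
        (tiltedDensity ψ ε x y * tiltedRate ε (mixingRate ψ x y) ^ l) =
      ∫⁻ y in Ioi 0, ENNReal.ofReal (momentKernel ψ ε l x y) := by
  have hT0 : ∀ y, 0 ≤ y → 0 ≤ tiltedRate ε (mixingRate ψ x y) := fun y hy =>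
    tiltedRate_nonneg hε (h.mixingRate_nonneg hx hy)
  have hh0 : ∀ y, 0 ≤ y → 0 ≤ l * tiltedRate ε (mixingRate ψ x y) ^ (l - 1) *
        (Real.exp (-ε * mixingRate ψ x y) * deriv ψ (x + y)) := fun y hy =>
    mul_nonneg (mul_nonneg l.cast_nonneg (pow_nonneg (hT0 y hy) _))
      (mul_nonneg (Real.exp_pos _).le (h.deriv_nonneg (x + y) (by linarith)))
  have hH0 : tiltedRate ε (mixingRate ψ x 0) ^ l = 0 := by
    simp [mixingRate, tiltedRate_zero_right, show l ≠ 0 by omega]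
  have key := lintegral_mul_ofReal_primitive
    ((h.measurable_tiltedDensity ε).comp (measurable_prodMk_left (x := x)))
    (h.measurable_tiltedRate_pow_deriv ε x l)
    (fun y hy => h.hasDerivAt_tiltedRate_pow hx hy l) hH0 hh0
    (fun y hy => h.hasDerivAt_deriv_mul_exp hx hy)
    (fun y hy => h.tiltedDensity_nonneg hε hx hy) (h.tendsto_deriv_mul_exp hε hx)
  refine Eq.trans (setLIntegral_congr_fun measurableSet_Ioi fun y hy => ?_)
    (key.trans (setLIntegral_congr_fun measurableSet_Ioi fun y hy => ?_))
  · exact ENNReal.ofReal_mul (h.tiltedDensity_nonneg hε hx (le_of_lt hy))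
  · have h3 : Real.exp (-(2 * ε) * mixingRate ψ x y) =
        Real.exp (-ε * mixingRate ψ x y) * Real.exp (-ε * mixingRate ψ x y) := by
      rw [← Real.exp_add]; ring_nf
    rw [← ENNReal.ofReal_mul (hh0 y (le_of_lt hy)), momentKernel, h3]
    congr 1
    ring

/-- Integration by parts of the mixed factorial moments. -/
lemma setLIntegral_tiltedDensity_mul_pow {ε : ℝ} (hε : 0 ≤ ε) {l : ℕ} (hl : 1 ≤ l) :
    ∫⁻ z in quadrant, ENNReal.ofReal
        (tiltedDensity ψ ε z.1 z.2 * tiltedRate ε (mixingRate ψ z.1 z.2) ^ l) =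
      ∫⁻ z in quadrant, ENNReal.ofReal (momentKernel ψ ε l z.1 z.2) := by
  have h1 := h.measurable_tiltedDensity ε
  have h2 : Measurable fun z : ℝ × ℝ => tiltedRate ε (mixingRate ψ z.1 z.2) :=
    (measurable_tiltedRate ε).comp h.measurable_mixingRate
  have h3 : Measurable fun z : ℝ × ℝ => ENNReal.ofReal
      (tiltedDensity ψ ε z.1 z.2 * tiltedRate ε (mixingRate ψ z.1 z.2) ^ l) :=
    (h1.mul (h2.pow_const l)).ennreal_ofReal
  rw [setLIntegral_quadrant h3,
    setLIntegral_quadrant (h.measurable_momentKernel ε l).ennreal_ofReal]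
  exact setLIntegral_congr_fun measurableSet_Ioi fun x hx =>
    h.lintegral_tiltedDensity_mul_pow hε hx hl

lemma mixingDensity_nonneg {x y : ℝ} (hx : 0 < x) (hy : 0 ≤ y) : 0 ≤ mixingDensity ψ x y := by
  rw [← tiltedDensity_zero]; exact h.tiltedDensity_nonneg le_rfl hx hy

lemma measurable_mixingDensity : Measurable fun z : ℝ × ℝ => mixingDensity ψ z.1 z.2 := by
  simpa only [tiltedDensity_zero] using h.measurable_tiltedDensity 0

/-- The mixing density has total mass `1`: the `y`-integral is `ψ'(x) exp (-ψ x)` since `ψ'` vanishes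
at infinity, and the `x`-integral is `1` since `ψ` increases from `0` to infinity. -/
lemma setLIntegral_mixingDensity :
    ∫⁻ z in quadrant, ENNReal.ofReal (mixingDensity ψ z.1 z.2) = 1 := by
  rw [setLIntegral_quadrant h.measurable_mixingDensity.ennreal_ofReal]
  have h1 : ∀ x ∈ Ioi (0 : ℝ), ∫⁻ y in Ioi 0, ENNReal.ofReal (mixingDensity ψ x y) =
      ENNReal.ofReal (deriv ψ x * Real.exp (-ψ x)) := by
    intro x hx
    have := lintegral_Ioi_eq_of_hasDerivAt (a := 0)
      (fun y hy => h.hasDerivAt_deriv_mul_exp (ε := 0) hx hy)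
      (fun y hy => h.tiltedDensity_nonneg le_rfl hx hy) (h.tendsto_deriv_mul_exp le_rfl hx)
    simpa [tiltedDensity_zero] using this
  rw [setLIntegral_congr_fun measurableSet_Ioi h1]
  have hc : ContinuousWithinAt (fun x => -Real.exp (-ψ x)) (Ici 0) 0 :=
    (Real.continuous_exp.continuousAt.comp_continuousWithinAt h.continuousWithinAt_zero.neg).neg
  have hd : ∀ x ∈ Ioi (0 : ℝ), HasDerivAt (fun x => -Real.exp (-ψ x))
      (deriv ψ x * Real.exp (-ψ x)) x := fun x hx =>
    ((h.hasDerivAt hx).neg.exp.neg).congr_deriv (by simp [mul_comm])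
  have hn : ∀ x ∈ Ioi (0 : ℝ), 0 ≤ deriv ψ x * Real.exp (-ψ x) := fun x hx =>
    mul_nonneg (h.deriv_nonneg x hx) (Real.exp_pos _).le
  have hl : Tendsto (fun x => -Real.exp (-ψ x)) atTop (𝓝 0) := by
    have := (Real.tendsto_exp_neg_atTop_nhds_zero.comp h.tendsto_atTop).neg
    simpa using this
  rw [← ofReal_integral_eq_lintegral_ofReal (integrableOn_Ioi_deriv_of_nonneg hc hd hn hl)
    ((ae_restrict_mem measurableSet_Ioi).mono hn),
    integral_Ioi_of_hasDerivAt_of_nonneg hc hd hn hl]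
  simp [h.map_zero]

lemma isProbabilityMeasure_mixingMeasure : IsProbabilityMeasure (mixingMeasure ψ) :=
  ⟨by rw [mixingMeasure, withDensity_apply _ MeasurableSet.univ, Measure.restrict_univ,
    h.setLIntegral_mixingDensity]⟩

lemma lintegral_mixingMeasure {F : ℝ × ℝ → ℝ≥0∞} (hF : Measurable F) :
    ∫⁻ z, F z ∂(mixingMeasure ψ) =
      ∫⁻ z in quadrant, ENNReal.ofReal (mixingDensity ψ z.1 z.2) * F z := by
  rw [mixingMeasure, lintegral_withDensity_eq_lintegral_mul _
    h.measurable_mixingDensity.ennreal_ofReal hF]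
  rfl

end IsDriftlessExponent

/-! ### The Laplace exponent of a subordinator -/

section nonneg
variable {Ω : Type*} [MeasurableSpace Ω] {P : Measure Ω} [IsProbabilityMeasure P] {X : Ω → ℝ}

lemma integrable_exp_neg_mul (hX : Measurable X) (hX0 : ∀ᵐ ω ∂P, 0 ≤ X ω) {s : ℝ} (hs : 0 ≤ s) :
    Integrable (fun ω => Real.exp (-s * X ω)) P := by
  refine Integrable.of_bound (by fun_prop) 1 (hX0.mono fun ω hω => ?_)
  rw [Real.norm_eq_abs, Real.abs_exp, Real.exp_le_one_iff]
  nlinarith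

lemma neg_mem_interior_integrableExpSet (hX : Measurable X) (hX0 : ∀ᵐ ω ∂P, 0 ≤ X ω) {s : ℝ}
    (hs : 0 < s) : -s ∈ interior (integrableExpSet X P) := by
  refine mem_interior.2 ⟨Iio 0, fun t ht => ?_, isOpen_Iio, neg_lt_zero.2 hs⟩
  have := integrable_exp_neg_mul hX hX0 (s := -t) (by simpa using le_of_lt ht)
  simpa [integrableExpSet] using this

lemma hasDerivAt_integral_pow_mul_exp_neg (hX : Measurable X) (hX0 : ∀ᵐ ω ∂P, 0 ≤ X ω) {s : ℝ}
    (hs : 0 < s) (k : ℕ) :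
    HasDerivAt (fun s => ∫ ω, X ω ^ k * Real.exp (-s * X ω) ∂P)
      (-∫ ω, X ω ^ (k + 1) * Real.exp (-s * X ω) ∂P) s := by
  have := (hasDerivAt_integral_pow_mul_exp_real
    (neg_mem_interior_integrableExpSet hX hX0 hs) k).comp s (hasDerivAt_neg s)
  simpa [Function.comp_def] using this

/-- If `exp (-c ψ)` is the Laplace transform of `X ≥ 0`, then the transforms of `X` and `X²` are its
first two derivatives up to sign. -/
lemma integral_mul_exp_neg_eq_of_exponent (hX : Measurable X) (hX0 : ∀ᵐ ω ∂P, 0 ≤ X ω)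
    {ψ : ℝ → ℝ} (hψ : ContDiffOn ℝ 2 ψ (Ioi 0)) {c : ℝ}
    (h : ∀ s, 0 < s → ∫ ω, Real.exp (-s * X ω) ∂P = Real.exp (-(c * ψ s))) {s : ℝ} (hs : 0 < s) :
    ∫ ω, X ω * Real.exp (-s * X ω) ∂P = c * deriv ψ s * Real.exp (-(c * ψ s)) ∧
    ∫ ω, X ω ^ 2 * Real.exp (-s * X ω) ∂P =
      ((c * deriv ψ s) ^ 2 - c * deriv (deriv ψ) s) * Real.exp (-(c * ψ s)) := by
  have d1 : ∀ s, 0 < s → HasDerivAt ψ (deriv ψ s) s := fun s hs =>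
    ((hψ.differentiableOn (by norm_num)).differentiableAt (Ioi_mem_nhds hs)).hasDerivAt
  have d2 : HasDerivAt (deriv ψ) (deriv (deriv ψ) s) s :=
    ((((contDiffOn_succ_iff_deriv_of_isOpen (n := 1) isOpen_Ioi).1 hψ).2.2.differentiableOn
      (by norm_num)).differentiableAt (Ioi_mem_nhds hs)).hasDerivAt
  have e1 : ∀ s, 0 < s → HasDerivAt (fun s => Real.exp (-(c * ψ s)))
      (Real.exp (-(c * ψ s)) * -(c * deriv ψ s)) s := fun s hs =>
    ((d1 s hs).const_mul c).fun_neg.exp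
  have f1 : ∀ s, 0 < s → ∫ ω, X ω * Real.exp (-s * X ω) ∂P =
      c * deriv ψ s * Real.exp (-(c * ψ s)) := by
    intro s hs
    have g := hasDerivAt_integral_pow_mul_exp_neg hX hX0 hs 0
    simp only [pow_zero, one_mul, zero_add, pow_one] at g
    have := g.unique ((e1 s hs).congr_of_eventuallyEq
      (eventually_of_mem (Ioi_mem_nhds hs) fun s hs => h s hs))
    linarith
  refine ⟨f1 s hs, ?_⟩
  have g := hasDerivAt_integral_pow_mul_exp_neg hX hX0 hs 1
  simp only [pow_one, one_add_one_eq_two] at g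
  have e2 := (d2.const_mul c).fun_mul (e1 s hs)
  have := g.unique (e2.congr_of_eventuallyEq
    (eventually_of_mem (Ioi_mem_nhds hs) fun s hs => f1 s hs))
  linear_combination -this

end nonneg

section subordinator
variable {Ω : Type*} [MeasurableSpace Ω] {P : Measure Ω}
  {ξ : ℝ → Ω → ℝ}

namespace IsSubordinator

lemma ae_nonneg (hξ : IsSubordinator P ξ) {t : ℝ} (ht : t ∈ Icc (0 : ℝ) 1) :
    ∀ᵐ ω ∂P, 0 ≤ ξ t ω := by
  filter_upwards [hξ.zero, hξ.paths] with ω h0 h1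
  rw [← h0]
  exact h1.1 (by simp) ht ht.1

lemma div_mem_Icc {n k : ℕ} (hk : k ≤ n) : (k : ℝ) / n ∈ Icc (0 : ℝ) 1 :=
  ⟨by positivity, div_le_one_of_le₀ (by exact_mod_cast hk) (by positivity)⟩

lemma succ_div_mem_Icc {n : ℕ} (i : Fin n) : (((i : ℕ) + 1 : ℝ)) / n ∈ Icc (0 : ℝ) 1 := by
  simpa using div_mem_Icc (n := n) (k := i + 1) i.2

lemma measurable_incrementWeights (hξ : IsSubordinator P ξ) (n : ℕ) (i : Fin n) :
    Measurable fun ω => incrementWeights ξ n ω i :=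
  (hξ.measurable _ (succ_div_mem_Icc i)).sub (hξ.measurable _ (div_mem_Icc i.2.le))

lemma ae_incrementWeights_nonneg (hξ : IsSubordinator P ξ) (n : ℕ) (i : Fin n) :
    ∀ᵐ ω ∂P, 0 ≤ incrementWeights ξ n ω i := by
  filter_upwards [hξ.paths] with ω h
  exact sub_nonneg.2 (h.1 (div_mem_Icc i.2.le) (succ_div_mem_Icc i) (by gcongr; simp))

lemma iIndepFun_incrementWeights (hξ : IsSubordinator P ξ) (n : ℕ) :
    iIndepFun (fun i ω => incrementWeights ξ n ω i) P := by
  have := hξ.indep_increments n (fun k => ⟨(k : ℕ) / n, div_mem_Icc (Nat.lt_succ_iff.1 k.2)⟩)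
    fun a b hab => by
      simp only [Subtype.mk_le_mk]
      gcongr
      exact hab
  simpa [incrementWeights] using this

lemma sum_incrementWeights {Ω : Type*} {ξ : ℝ → Ω → ℝ} {n : ℕ} (hn : n ≠ 0) (ω : Ω) :
    ∑ i, incrementWeights ξ n ω i = ξ 1 ω - ξ 0 ω := by
  have := Finset.sum_range_sub (fun k : ℕ => ξ ((k : ℝ) / n) ω) n
  rw [← Fin.sum_univ_eq_sum_range (fun k : ℕ => ξ (((k + 1 : ℕ) : ℝ) / n) ω - ξ ((k : ℝ) / n) ω)]
    at this
  have hn' : (n : ℝ) ≠ 0 := by exact_mod_cast hn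
  simpa [incrementWeights, hn'] using this

lemma identDistrib_incrementWeights (hξ : IsSubordinator P ξ) {n : ℕ} (i : Fin n) :
    IdentDistrib (fun ω => incrementWeights ξ n ω i) (ξ (1 / n)) P P := by
  have := hξ.stationary_increments ((i : ℕ) / n) (((i : ℕ) + 1 : ℝ) / n) (by positivity)
    (by gcongr; simp) (succ_div_mem_Icc i).2
  rwa [← sub_div, add_sub_cancel_left] at this

variable [IsProbabilityMeasure P]

lemma integral_exp_one_pos (hξ : IsSubordinator P ξ) {s : ℝ} (hs : 0 ≤ s) :
    0 < ∫ ω, Real.exp (-s * ξ 1 ω) ∂P :=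
  integral_exp_pos (integrable_exp_neg_mul (hξ.measurable 1 (by simp)) (hξ.ae_nonneg (by simp)) hs)

lemma exp_neg_laplaceExponent (hξ : IsSubordinator P ξ) {s : ℝ} (hs : 0 ≤ s) :
    Real.exp (-laplaceExponent P ξ s) = ∫ ω, Real.exp (-s * ξ 1 ω) ∂P := by
  rw [laplaceExponent, neg_neg, Real.exp_log (hξ.integral_exp_one_pos hs)]

/-- The increments over intervals of length `1/n` have Laplace exponent `ψ / n`. -/
lemma integral_exp_incrementWeights (hξ : IsSubordinator P ξ) {n : ℕ} (i : Fin n) {s : ℝ}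
    (hs : 0 ≤ s) : ∫ ω, Real.exp (-s * incrementWeights ξ n ω i) ∂P =
      Real.exp (-(1 / n * laplaceExponent P ξ s)) := by
  have hn : n ≠ 0 := fun e => by subst e; exact i.elim0
  have hn' : (n : ℝ) ≠ 0 := by exact_mod_cast hn
  have h1 : mgf (∑ i, fun ω => incrementWeights ξ n ω i) P (-s) =
      ∏ i, mgf (fun ω => incrementWeights ξ n ω i) P (-s) :=
    (hξ.iIndepFun_incrementWeights n).mgf_sum (hξ.measurable_incrementWeights n) Finset.univ
  have h2 : mgf (∑ i, fun ω => incrementWeights ξ n ω i) P (-s) =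
      Real.exp (-laplaceExponent P ξ s) := by
    rw [hξ.exp_neg_laplaceExponent hs]
    refine integral_congr_ae (hξ.zero.mono fun ω hω => ?_)
    simp only [Finset.sum_apply, sum_incrementWeights hn, hω, sub_zero]
  have h3 : ∀ k, mgf (fun ω => incrementWeights ξ n ω k) P (-s) =
      mgf (fun ω => incrementWeights ξ n ω i) P (-s) := fun k => by
    rw [mgf_congr_identDistrib (hξ.identDistrib_incrementWeights k),
      mgf_congr_identDistrib (hξ.identDistrib_incrementWeights i)]
  rw [h2, Finset.prod_congr rfl fun k _ => h3 k, Finset.prod_const, Finset.card_univ,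
    Fintype.card_fin] at h1
  have h4 : Real.exp (-(1 / n * laplaceExponent P ξ s)) ^ n =
      Real.exp (-laplaceExponent P ξ s) := by
    rw [← Real.exp_nat_mul]; congr 1; field_simp
  exact (pow_left_inj₀ mgf_nonneg (Real.exp_pos _).le hn).1 (h1.symm.trans h4.symm)

lemma contDiffOn_laplaceExponent (hξ : IsSubordinator P ξ) :
    ContDiffOn ℝ 2 (laplaceExponent P ξ) (Ioi 0) := by
  have h1 : AnalyticOnNhd ℝ (fun s => -cgf (ξ 1) P (-s)) (Ioi 0) := fun s hs =>
    ((analyticAt_cgf (neg_mem_interior_integrableExpSet (hξ.measurable 1 (by simp))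
      (hξ.ae_nonneg (by simp)) hs)).comp_of_eq (analyticAt_id.neg) rfl).neg
  exact h1.contDiffOn (uniqueDiffOn_Ioi 0)

lemma measurable_laplaceExponent (hξ : IsSubordinator P ξ) :
    Measurable (laplaceExponent P ξ) := by
  have h1 := hξ.measurable 1 (by simp)
  have : StronglyMeasurable fun s => ∫ ω, Real.exp (-s * ξ 1 ω) ∂P := by
    refine StronglyMeasurable.integral_prod_right' (f := fun q : ℝ × Ω => Real.exp (-q.1 * ξ 1 q.2))
      (Measurable.stronglyMeasurable ?_)
    fun_prop
  exact (Real.measurable_log.comp this.measurable).neg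

lemma continuousWithinAt_laplaceExponent_zero (hξ : IsSubordinator P ξ) :
    ContinuousWithinAt (laplaceExponent P ξ) (Ici 0) 0 := by
  have h1 := hξ.measurable 1 (by simp)
  have : ContinuousWithinAt (fun s => ∫ ω, Real.exp (-s * ξ 1 ω) ∂P) (Ici 0) 0 := by
    refine continuousWithinAt_of_dominated (bound := fun _ => 1)
      (Eventually.of_forall fun s => by fun_prop) ?_ (integrable_const _)
      (Eventually.of_forall fun ω => by fun_prop)
    filter_upwards [self_mem_nhdsWithin] with s hs
    filter_upwards [hξ.ae_nonneg (t := 1) (by simp)] with ω hω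
    rw [Real.norm_eq_abs, Real.abs_exp, Real.exp_le_one_iff]
    have : 0 ≤ s := hs
    nlinarith
  exact (this.log (hξ.integral_exp_one_pos le_rfl).ne').neg

lemma laplaceExponent_zero : laplaceExponent P ξ 0 = 0 := by simp [laplaceExponent]

lemma deriv_laplaceExponent_nonneg (hξ : IsSubordinator P ξ) {s : ℝ} (hs : 0 < s) :
    0 ≤ deriv (laplaceExponent P ξ) s := by
  have h := (integral_mul_exp_neg_eq_of_exponent (hξ.measurable_incrementWeights 1 0)
    (hξ.ae_incrementWeights_nonneg 1 0) hξ.contDiffOn_laplaceExponent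
    (fun s hs => hξ.integral_exp_incrementWeights 0 hs.le) hs).1
  have h0 : 0 ≤ ∫ ω, incrementWeights ξ 1 ω 0 * Real.exp (-s * incrementWeights ξ 1 ω 0) ∂P :=
    integral_nonneg_of_ae ((hξ.ae_incrementWeights_nonneg 1 0).mono fun ω hω =>
      mul_nonneg hω (Real.exp_pos _).le)
  rw [h] at h0
  simpa using nonneg_of_mul_nonneg_left h0 (Real.exp_pos _)

/-- Infinite divisibility forces concavity: `ψ'² / n - ψ''` is nonnegative for all `n`, being `n`
times a second derivative of the Laplace transform `exp (-ψ / n)` up to a positive factor. -/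
lemma deriv_deriv_laplaceExponent_nonpos (hξ : IsSubordinator P ξ) {s : ℝ} (hs : 0 < s) :
    deriv (deriv (laplaceExponent P ξ)) s ≤ 0 := by
  set ψ := laplaceExponent P ξ
  have h : ∀ n : ℕ, deriv (deriv ψ) s ≤ 1 / ((n : ℝ) + 1) * deriv ψ s ^ 2 := by
    intro n
    have h := (integral_mul_exp_neg_eq_of_exponent (hξ.measurable_incrementWeights (n + 1) 0)
      (hξ.ae_incrementWeights_nonneg (n + 1) 0) hξ.contDiffOn_laplaceExponent
      (fun s hs => hξ.integral_exp_incrementWeights 0 hs.le) hs).2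
    have h0 : 0 ≤ ∫ ω, incrementWeights ξ (n + 1) ω 0 ^ 2 *
        Real.exp (-s * incrementWeights ξ (n + 1) ω 0) ∂P :=
      integral_nonneg fun ω => mul_nonneg (sq_nonneg _) (Real.exp_pos _).le
    rw [h] at h0
    have h1 := nonneg_of_mul_nonneg_left h0 (Real.exp_pos _)
    have hc : (0 : ℝ) < 1 / ((n : ℝ) + 1) := by positivity
    push_cast at h1
    have h2 : 0 ≤ 1 / ((n : ℝ) + 1) *
        (1 / ((n : ℝ) + 1) * deriv ψ s ^ 2 - deriv (deriv ψ) s) := by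
      refine h1.trans_eq ?_
      ring
    linarith [nonneg_of_mul_nonneg_right h2 hc]
  have hlim : Tendsto (fun n : ℕ => 1 / ((n : ℝ) + 1) * deriv ψ s ^ 2) atTop (𝓝 0) := by
    simpa using tendsto_one_div_add_atTop_nhds_zero_nat.mul_const (deriv ψ s ^ 2)
  exact ge_of_tendsto' hlim h

end IsSubordinator

namespace HasLevyMeasure
variable {ν : Measure ℝ}

lemma integrableOn_min (hν : HasLevyMeasure P ξ ν) :
    IntegrableOn (fun y : ℝ => min 1 y) (Ioi 0) ν := by
  refine ⟨by fun_prop, ?_⟩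
  rw [hasFiniteIntegral_iff_ofReal]
  · exact hν.lintegral_min_lt_top
  · exact (ae_restrict_mem measurableSet_Ioi).mono fun y hy => le_min zero_le_one (le_of_lt hy)

lemma one_sub_exp_le {s y : ℝ} (hs : 1 ≤ s) :
    1 - Real.exp (-s * y) ≤ s * min 1 y := by
  rcases min_cases 1 y with ⟨h, -⟩ | ⟨h, -⟩ <;> rw [h]
  · linarith [Real.exp_pos (-s * y)]
  · linarith [Real.add_one_le_exp (-s * y)]

lemma one_sub_exp_nonneg {s y : ℝ} (hs : 0 ≤ s) (hy : 0 < y) : 0 ≤ 1 - Real.exp (-s * y) :=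
  sub_nonneg.2 (Real.exp_le_one_iff.2 (by nlinarith))

lemma integrableOn_one_sub_exp (hν : HasLevyMeasure P ξ ν) {s : ℝ} (hs : 1 ≤ s) :
    IntegrableOn (fun y => 1 - Real.exp (-s * y)) (Ioi 0) ν := by
  refine Integrable.mono' (hν.integrableOn_min.const_mul s) (by fun_prop) ?_
  refine (ae_restrict_mem measurableSet_Ioi).mono fun y hy => ?_
  rw [Real.norm_of_nonneg (one_sub_exp_nonneg (by linarith) hy)]
  exact one_sub_exp_le hs

lemma tendsto_laplaceExponent (hν : HasLevyMeasure P ξ ν) (hinf : ν (Ioi 0) = ∞) :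
    Tendsto (laplaceExponent P ξ) atTop atTop := by
  have hmono : ∀ s t : ℝ, 1 ≤ s → s ≤ t → laplaceExponent P ξ s ≤ laplaceExponent P ξ t := by
    intro s t hs hst
    rw [hν.laplaceExponent_eq s (by linarith), hν.laplaceExponent_eq t (by linarith)]
    refine setIntegral_mono_on (hν.integrableOn_one_sub_exp hs)
      (hν.integrableOn_one_sub_exp (hs.trans hst)) measurableSet_Ioi fun y hy => ?_
    have : 0 < y := hy
    gcongr
  refine tendsto_atTop.2 fun C => ?_
  by_contra hC
  have hbd : ∀ n : ℕ, laplaceExponent P ξ (n + 1) ≤ C := by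
    intro n
    by_contra! hn
    refine hC ?_
    filter_upwards [eventually_ge_atTop ((n : ℝ) + 1)] with s hs
    exact hn.le.trans (hmono _ _ (by linarith [n.cast_nonneg (α := ℝ)]) hs)
  -- Fatou's lemma bounds the total mass of `ν` by `C`
  have hlim : ∀ y ∈ Ioi (0 : ℝ), (1 : ℝ≥0∞) =
      liminf (fun n : ℕ => ENNReal.ofReal (1 - Real.exp (-((n : ℝ) + 1) * y))) atTop := by
    intro y hy
    have h1 : Tendsto (fun n : ℕ => -((n : ℝ) + 1) * y) atTop atBot := by
      simp only [neg_mul]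
      exact tendsto_neg_atTop_atBot.comp
        ((tendsto_atTop_add_const_right _ _ tendsto_natCast_atTop_atTop).atTop_mul_const hy)
    have h2 := ENNReal.tendsto_ofReal ((Real.tendsto_exp_atBot.comp h1).const_sub 1)
    simp only [sub_zero, ENNReal.ofReal_one] at h2
    exact h2.liminf_eq.symm
  have hle : ν (Ioi 0) ≤ ENNReal.ofReal C := by
    calc ν (Ioi 0) = ∫⁻ y in Ioi 0, 1 ∂ν := by simp
      _ = ∫⁻ y in Ioi 0, liminf (fun n : ℕ =>
            ENNReal.ofReal (1 - Real.exp (-((n : ℝ) + 1) * y))) atTop ∂ν :=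
          setLIntegral_congr_fun measurableSet_Ioi hlim
      _ ≤ liminf (fun n : ℕ => ∫⁻ y in Ioi 0,
            ENNReal.ofReal (1 - Real.exp (-((n : ℝ) + 1) * y)) ∂ν) atTop :=
          lintegral_liminf_le fun n => by fun_prop
      _ ≤ ENNReal.ofReal C := by
          refine liminf_le_of_le (by isBoundedDefault) fun b hb => ?_
          obtain ⟨n, hn⟩ := hb.exists
          refine hn.trans ?_
          have h1 : (1 : ℝ) ≤ (n : ℝ) + 1 := by simp
          rw [← ofReal_integral_eq_lintegral_ofReal (hν.integrableOn_one_sub_exp h1)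
            ((ae_restrict_mem measurableSet_Ioi).mono fun y hy =>
              one_sub_exp_nonneg (by linarith) hy), ← hν.laplaceExponent_eq _ (by linarith)]
          exact ENNReal.ofReal_le_ofReal (hbd n)
  rw [hinf] at hle
  exact absurd hle (by simp)

/-- Absence of drift. -/
lemma tendsto_laplaceExponent_div (hν : HasLevyMeasure P ξ ν) :
    Tendsto (fun s => laplaceExponent P ξ s / s) atTop (𝓝 0) := by
  have h : Tendsto (fun s : ℝ => ∫ y in Ioi 0, (1 - Real.exp (-s * y)) / s ∂ν) atTop
      (𝓝 (∫ y in Ioi (0 : ℝ), 0 ∂ν)) := by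
    refine tendsto_integral_filter_of_dominated_convergence (fun y => min 1 y)
      (Eventually.of_forall fun s => by fun_prop) ?_ hν.integrableOn_min ?_
    · filter_upwards [eventually_ge_atTop 1] with s hs
      refine (ae_restrict_mem measurableSet_Ioi).mono fun y hy => ?_
      have hs0 : 0 < s := by linarith
      rw [Real.norm_of_nonneg (div_nonneg (one_sub_exp_nonneg hs0.le hy) hs0.le),
        div_le_iff₀ hs0]
      exact (one_sub_exp_le hs).trans_eq (mul_comm _ _)
    · refine (ae_restrict_mem measurableSet_Ioi).mono fun y hy => ?_
      refine squeeze_zero' ?_ ?_ tendsto_inv_atTop_zero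
      · filter_upwards [eventually_gt_atTop 0] with s hs
        exact div_nonneg (one_sub_exp_nonneg hs.le hy) hs.le
      · filter_upwards [eventually_gt_atTop 0] with s hs
        rw [inv_eq_one_div]
        gcongr
        linarith [Real.exp_pos (-s * y)]
  rw [integral_zero] at h
  refine h.congr' ?_
  filter_upwards [eventually_gt_atTop 0] with s hs
  rw [integral_div, hν.laplaceExponent_eq s hs.le]

end HasLevyMeasure

variable [IsProbabilityMeasure P]

lemma IsSubordinator.tendsto_deriv_laplaceExponent (hξ : IsSubordinator P ξ) {ν : Measure ℝ}
    (hν : HasLevyMeasure P ξ ν) : Tendsto (deriv (laplaceExponent P ξ)) atTop (𝓝 0) := by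
  have hC := hξ.contDiffOn_laplaceExponent
  have hD : ∀ s, 0 < s → DifferentiableAt ℝ (laplaceExponent P ξ) s := fun s hs =>
    (hC.differentiableOn (by norm_num)).differentiableAt (Ioi_mem_nhds hs)
  have hC1 := ((contDiffOn_succ_iff_deriv_of_isOpen (n := 1) isOpen_Ioi).1 hC).2.2
  have hanti : AntitoneOn (deriv (laplaceExponent P ξ)) (Ioi 0) :=
    antitoneOn_of_deriv_nonpos (convex_Ioi 0) hC1.continuousOn
      ((hC1.differentiableOn (by norm_num)).mono interior_subset)
      fun s hs => hξ.deriv_deriv_laplaceExponent_nonpos (by simpa using hs)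
  have hlim := hν.tendsto_laplaceExponent_div.const_mul 2
  rw [mul_zero] at hlim
  refine squeeze_zero' ?_ ?_ hlim
  · filter_upwards [eventually_gt_atTop 0] with s hs using hξ.deriv_laplaceExponent_nonneg hs
  · -- by concavity, `ψ'(s)` is at most the slope of `ψ` between `s / 2` and `s`
    filter_upwards [eventually_gt_atTop 0] with s hs
    obtain ⟨c, hc, hcs⟩ := exists_deriv_eq_slope (laplaceExponent P ξ)
      (show s / 2 < s by linarith)
      (fun u hu => (hD u (by linarith [hu.1])).continuousAt.continuousWithinAt)
      (fun u hu => (hD u (by linarith [hu.1])).differentiableWithinAt)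
    have h1 := hanti (show c ∈ Ioi 0 from by have := hc.1; simp; linarith) hs hc.2.le
    have h2 : 0 ≤ laplaceExponent P ξ (s / 2) := by
      rw [hν.laplaceExponent_eq _ (by linarith)]
      exact setIntegral_nonneg measurableSet_Ioi fun y hy =>
        HasLevyMeasure.one_sub_exp_nonneg (by linarith) hy
    refine h1.trans (hcs.trans_le ?_)
    rw [show s - s / 2 = s / 2 by ring, div_le_iff₀ (by linarith)]
    have : 2 * (laplaceExponent P ξ s / s) * (s / 2) = laplaceExponent P ξ s := by field_simp
    linarith

lemma IsSubordinator.isDriftlessExponent (hξ : IsSubordinator P ξ) {ν : Measure ℝ}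
    (hν : HasLevyMeasure P ξ ν) (hinf : ν (Ioi 0) = ∞) :
    IsDriftlessExponent (laplaceExponent P ξ) where
  measurable := hξ.measurable_laplaceExponent
  contDiffOn := hξ.contDiffOn_laplaceExponent
  deriv_nonneg _ hs := hξ.deriv_laplaceExponent_nonneg hs
  deriv_deriv_nonpos _ hs := hξ.deriv_deriv_laplaceExponent_nonpos hs
  map_zero := IsSubordinator.laplaceExponent_zero
  continuousWithinAt_zero := hξ.continuousWithinAt_laplaceExponent_zero
  tendsto_atTop := hν.tendsto_laplaceExponent hinf
  tendsto_deriv := hξ.tendsto_deriv_laplaceExponent hν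

/-- Infinite activity makes all increments positive. -/
lemma IsSubordinator.ae_incrementWeights_pos (hξ : IsSubordinator P ξ) {ν : Measure ℝ}
    (hν : HasLevyMeasure P ξ ν) (hinf : ν (Ioi 0) = ∞) {n : ℕ} (i : Fin n) :
    ∀ᵐ ω ∂P, 0 < incrementWeights ξ n ω i := by
  have hn : (0 : ℝ) < n := by exact_mod_cast i.pos
  have hm := hξ.measurable_incrementWeights n i
  have hset : MeasurableSet {ω | incrementWeights ξ n ω i = 0} := hm (measurableSet_singleton 0)
  have hle : ∀ᶠ s : ℝ in atTop, P.real {ω | incrementWeights ξ n ω i = 0} ≤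
      Real.exp (-(1 / n * laplaceExponent P ξ s)) := by
    filter_upwards [eventually_ge_atTop 0] with s hs
    rw [← hξ.integral_exp_incrementWeights i hs, ← integral_indicator_one hset]
    refine integral_mono_of_nonneg (Eventually.of_forall fun ω => indicator_nonneg (by simp) _)
      (integrable_exp_neg_mul hm (hξ.ae_incrementWeights_nonneg n i) hs)
      (Eventually.of_forall fun ω => ?_)
    refine indicator_le_self' (s := {ω | incrementWeights ξ n ω i = 0})
      (f := fun ω => Real.exp (-s * incrementWeights ξ n ω i))
      (fun ω _ => (Real.exp_pos _).le) ω |>.trans' ?_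
    by_cases h : incrementWeights ξ n ω i = 0 <;> simp [h]
  have hlim : Tendsto (fun s => Real.exp (-(1 / n * laplaceExponent P ξ s))) atTop (𝓝 0) :=
    Real.tendsto_exp_neg_atTop_nhds_zero.comp
      ((hν.tendsto_laplaceExponent hinf).const_mul_atTop (by positivity))
  have h0 : P {ω | incrementWeights ξ n ω i = 0} = 0 :=
    (measureReal_eq_zero_iff).1 (le_antisymm (ge_of_tendsto hlim hle) measureReal_nonneg)
  filter_upwards [hξ.ae_incrementWeights_nonneg n i, measure_eq_zero_iff_ae_notMem.1 h0]
    with ω h1 h2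
  exact lt_of_le_of_ne h1 fun e => h2 e.symm

end subordinator

/-! ### Binomial mixtures and their Poisson limits -/

/-- The binomial probability of `j` successes among `m` trials. -/
noncomputable def binomialWeight (m : ℕ) (q : ℝ) (j : ℕ) : ℝ :=
  m.choose j * q ^ j * (1 - q) ^ (m - j)

lemma binomialWeight_nonneg {m : ℕ} {q : ℝ} (hq : q ∈ Icc (0 : ℝ) 1) (j : ℕ) :
    0 ≤ binomialWeight m q j :=
  mul_nonneg (mul_nonneg (Nat.cast_nonneg _) (pow_nonneg hq.1 _)) (pow_nonneg (by linarith [hq.2]) _)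

/-- The factorial moments of the binomial distribution. -/
lemma sum_descFactorial_mul_binomialWeight (m l : ℕ) (q : ℝ) :
    ∑ j ∈ Finset.range (m + 1), (j.descFactorial l : ℝ) * binomialWeight m q j =
      m.descFactorial l * q ^ l := by
  rcases lt_or_ge m l with hlt | hle
  · rw [Nat.descFactorial_of_lt hlt, Finset.sum_eq_zero]
    · simp
    · intro j hj
      rw [Nat.descFactorial_of_lt (by have := Finset.mem_range.1 hj; omega)]
      simp
  · obtain ⟨r, rfl⟩ := Nat.exists_eq_add_of_le hle
    rw [add_assoc, Finset.sum_range_add, Finset.sum_eq_zero, zero_add]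
    · have hterm : ∀ i ∈ Finset.range (r + 1),
          ((l + i).descFactorial l : ℝ) * binomialWeight (l + r) q (l + i) =
          ((l + r).descFactorial l * q ^ l) * (q ^ i * (1 - q) ^ (r - i) * r.choose i) := by
        intro i hi
        have hir : i ≤ r := Nat.lt_succ_iff.1 (Finset.mem_range.1 hi)
        have h1 := Nat.choose_mul (n := l + r) (k := l + i) (s := l) (by omega)
        rw [Nat.add_sub_cancel_left, Nat.add_sub_cancel_left] at h1
        have h2 : (((l + r).choose (l + i) * (l + i).descFactorial l : ℕ) : ℝ) =
            ((l + r).descFactorial l * r.choose i : ℕ) := by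
          congr 1
          rw [Nat.descFactorial_eq_factorial_mul_choose, Nat.descFactorial_eq_factorial_mul_choose]
          linear_combination l.factorial * h1
        push_cast at h2
        rw [binomialWeight, show l + r - (l + i) = r - i by omega, pow_add]
        linear_combination q ^ l * q ^ i * (1 - q) ^ (r - i) * h2
      rw [Finset.sum_congr rfl hterm, ← Finset.mul_sum, ← add_pow]
      simp
    · intro j hj
      rw [Nat.descFactorial_of_lt (Finset.mem_range.1 hj)]
      simp

/-- Powers in terms of falling factorials. -/
lemma pow_eq_sum_stirlingSecond_mul_descFactorial (k j : ℕ) :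
    j ^ k = ∑ l ∈ Finset.range (k + 1), Nat.stirlingSecond k l * j.descFactorial l := by
  induction k with
  | zero => simp
  | succ k ih =>
    have hmul : ∀ l, j * j.descFactorial l = j.descFactorial (l + 1) + l * j.descFactorial l := by
      intro l
      rcases lt_or_ge j l with h | h
      · simp [Nat.descFactorial_of_lt h]
      · rw [Nat.descFactorial_succ, ← add_mul, Nat.sub_add_cancel h]
    have hshift : ∑ l ∈ Finset.range (k + 1),
        (l + 1) * Nat.stirlingSecond k (l + 1) * j.descFactorial (l + 1) =
        ∑ l ∈ Finset.range (k + 1), l * Nat.stirlingSecond k l * j.descFactorial l := by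
      rw [Finset.sum_range_succ, Finset.sum_range_succ',
        Nat.stirlingSecond_eq_zero_of_lt (Nat.lt_succ_self k)]
      simp
    rw [pow_succ, ih, Finset.sum_mul, Finset.sum_range_succ' _ (k + 1)]
    have hrec : ∀ l, Nat.stirlingSecond (k + 1) (l + 1) * j.descFactorial (l + 1) =
        (l + 1) * Nat.stirlingSecond k (l + 1) * j.descFactorial (l + 1) +
          Nat.stirlingSecond k l * j.descFactorial (l + 1) := fun l => by
      rw [Nat.stirlingSecond_succ_succ, add_mul]
    rw [Finset.sum_congr rfl fun l _ => hrec l, Finset.sum_add_distrib, hshift,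
      ← Finset.sum_add_distrib, Nat.stirlingSecond_succ_zero, zero_mul, add_zero]
    refine Finset.sum_congr rfl fun l _ => ?_
    rw [mul_assoc, mul_comm _ j, hmul]
    ring

lemma tendsto_one_div_succ : Tendsto (fun m : ℕ => 1 / ((m : ℝ) + 1)) atTop (𝓝 0) :=
  tendsto_one_div_add_atTop_nhds_zero_nat

lemma tiltedRate_one_div_succ (m : ℕ) (r : ℝ) : tiltedRate (1 / ((m : ℝ) + 1)) r =
    ((m : ℝ) + 1) * (1 - Real.exp (-(1 / ((m : ℝ) + 1)) * r)) := by
  have : (m : ℝ) + 1 ≠ 0 := by positivity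
  rw [tiltedRate, if_neg (by positivity)]
  field_simp

lemma one_sub_exp_mem_Icc {ε r : ℝ} (hε : 0 ≤ ε) (hr : 0 ≤ r) :
    1 - Real.exp (-ε * r) ∈ Icc (0 : ℝ) 1 :=
  ⟨sub_nonneg.2 (Real.exp_le_one_iff.2 (by nlinarith)), by linarith [Real.exp_pos (-ε * r)]⟩

/-- The Poisson limit with `m` trials of success probability `1 - exp (-r / (m + 1))`. -/
lemma tendsto_binomialWeight (r : ℝ) (j : ℕ) :
    Tendsto (fun m : ℕ => binomialWeight m (1 - Real.exp (-(1 / ((m : ℝ) + 1)) * r)) j) atTop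
      (𝓝 (Real.exp (-r) * r ^ j / j.factorial)) := by
  refine tendsto_choose_mul_pow_of_tendsto_mul_atTop j ?_
  have h1 := (tendsto_tiltedRate r).comp tendsto_one_div_succ
  have h2 : Tendsto (fun m : ℕ => 1 - 1 / ((m : ℝ) + 1)) atTop (𝓝 1) := by
    simpa using tendsto_one_div_succ.const_sub 1
  have h3 := h2.mul h1
  rw [one_mul] at h3
  refine h3.congr fun m => ?_
  have : (m : ℝ) + 1 ≠ 0 := by positivity
  simp only [Function.comp_apply, tiltedRate_one_div_succ]
  field_simp
  ring

lemma tendsto_tiltedDensity (ψ : ℝ → ℝ) (x y : ℝ) :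
    Tendsto (fun m : ℕ => tiltedDensity ψ (1 / ((m : ℝ) + 1)) x y) atTop
      (𝓝 (mixingDensity ψ x y)) := by
  have : Continuous fun ε => tiltedDensity ψ ε x y := by unfold tiltedDensity; fun_prop
  rw [← tiltedDensity_zero]
  exact (this.tendsto 0).comp tendsto_one_div_succ

lemma measurable_binomialWeight {ψ : ℝ → ℝ} (h : IsDriftlessExponent ψ) (m j : ℕ) (ε : ℝ) :
    Measurable fun z : ℝ × ℝ =>
      binomialWeight m (1 - Real.exp (-ε * mixingRate ψ z.1 z.2)) j := by
  have := h.measurable_mixingRate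
  unfold binomialWeight; fun_prop

/-- The law of the search cost of `m + 1` items is a mixture of binomial distributions. -/
lemma IsSubordinator.measure_searchCost {Ω : Type*} [MeasurableSpace Ω] {P : Measure Ω}
    [IsProbabilityMeasure P] {ξ : ℝ → Ω → ℝ} (hξ : IsSubordinator P ξ) {ν : Measure ℝ}
    (hν : HasLevyMeasure P ξ ν) (hinf : ν (Ioi 0) = ∞) {m : ℕ} {S : Ω → ℕ}
    (hS : IsStationarySearchCost P (incrementWeights ξ (m + 1)) S) (j : ℕ) :
    P {ω | S ω = j} = ∫⁻ z in quadrant,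
      ENNReal.ofReal (tiltedDensity (laplaceExponent P ξ) (1 / ((m : ℝ) + 1)) z.1 z.2) *
      ENNReal.ofReal (binomialWeight m
        (1 - Real.exp (-(1 / ((m : ℝ) + 1)) * mixingRate (laplaceExponent P ξ) z.1 z.2)) j) := by
  have hE := hξ.isDriftlessExponent hν hinf
  set ψ := laplaceExponent P ξ with hψ
  set ε : ℝ := 1 / ((m : ℝ) + 1) with hε
  have hε0 : 0 < ε := by positivity
  have hmε : ((m : ℝ) + 1) * ε = 1 := by rw [hε]; field_simp
  have hφ : ∀ (k : Fin (m + 1)) s, 0 < s →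
      ∫ ω, Real.exp (-s * incrementWeights ξ (m + 1) ω k) ∂P = Real.exp (-(ε * ψ s)) := by
    intro k s hs
    rw [hξ.integral_exp_incrementWeights k hs.le, hε, hψ]
    push_cast
    rfl
  have hlaw := hS.measure_eq (φ := fun s => Real.exp (-(ε * ψ s)))
    (φ₂ := fun s => ((ε * deriv ψ s) ^ 2 - ε * deriv (deriv ψ) s) * Real.exp (-(ε * ψ s)))
    (hξ.measurable_incrementWeights (m + 1)) (hξ.iIndepFun_incrementWeights (m + 1))
    (ae_all_iff.2 fun k => hξ.ae_incrementWeights_pos hν hinf k)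
    (fun k s hs => by simpa only [neg_mul] using hφ k s hs)
    (fun k s hs => by
      simpa only [neg_mul] using integrable_pow_mul_exp_of_mem_interior_integrableExpSet
        (neg_mem_interior_integrableExpSet (hξ.measurable_incrementWeights (m + 1) k)
          (hξ.ae_incrementWeights_nonneg (m + 1) k) hs) 2)
    (fun k s hs => by
      simpa only [neg_mul] using (integral_mul_exp_neg_eq_of_exponent
        (hξ.measurable_incrementWeights (m + 1) k) (hξ.ae_incrementWeights_nonneg (m + 1) k)
        hE.contDiffOn (hφ k) hs).2) j
  rw [hlaw]
  refine setLIntegral_congr_fun measurableSet_quadrant fun z hz => ?_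
  obtain ⟨x, y⟩ := z
  have hx : 0 < x := hz.1
  have hy : 0 < y := hz.2
  have hr := hE.mixingRate_nonneg hx hy.le
  have hd2 := hE.deriv_deriv_nonpos (x + y) (by positivity)
  have hφ₂ : 0 ≤ (ε * deriv ψ (x + y)) ^ 2 - ε * deriv (deriv ψ) (x + y) := by
    nlinarith [sq_nonneg (ε * deriv ψ (x + y))]
  have hsub : 0 ≤ Real.exp (-(ε * ψ x)) - Real.exp (-(ε * ψ (x + y))) := by
    rw [sub_nonneg]
    have : ψ x ≤ ψ (x + y) := sub_nonneg.1 hr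
    gcongr
  simp only [Nat.add_sub_cancel]
  rw [← ENNReal.ofReal_pow hsub, ← ENNReal.ofReal_pow (Real.exp_pos _).le,
    ← ENNReal.ofReal_mul (by positivity), ← ENNReal.ofReal_mul (by positivity),
    ← ENNReal.ofReal_natCast (m + 1), ← ENNReal.ofReal_natCast (m.choose j),
    ← ENNReal.ofReal_mul (by positivity), ← ENNReal.ofReal_mul (by positivity),
    ← ENNReal.ofReal_mul (hE.tiltedDensity_nonneg hε0.le hx hy.le)]
  congr 1
  rcases lt_or_ge m j with hj | hj
  · simp [binomialWeight, Nat.choose_eq_zero_of_lt hj]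
  have e1 : Real.exp (-(ε * ψ (x + y))) =
      Real.exp (-(ε * ψ x)) * Real.exp (-ε * mixingRate ψ x y) := by
    rw [← Real.exp_add, mixingRate]; ring_nf
  have e2 : Real.exp (-ψ x) = Real.exp (-(ε * ψ x)) ^ (m + 1) := by
    rw [← Real.exp_nat_mul]
    congr 1
    push_cast
    linear_combination ψ x * hmε
  obtain ⟨r, rfl⟩ := Nat.exists_eq_add_of_le hj
  simp only [tiltedDensity, binomialWeight, e1, e2, Nat.add_sub_cancel_left, sub_sub_cancel,
    ← mul_one_sub, mul_pow]
  push_cast at hmε ⊢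
  set a := Real.exp (-(ε * ψ x))
  set E := Real.exp (-ε * mixingRate ψ x y)
  linear_combination ((j + r).choose j : ℝ) * (1 - E) ^ j * E ^ r * E * a ^ (j + r + 1) *
    (ε * deriv ψ (x + y) ^ 2 - deriv (deriv ψ) (x + y)) * hmε

/-- The mixture of the Poisson distributions with parameter `ψ (x + y) - ψ x` with respect to the
mixing density. -/
noncomputable def mixedPoisson (ψ : ℝ → ℝ) : Measure ℕ :=
  Measure.sum fun j : ℕ =>
    (∫⁻ z, poissonMeasure (mixingRate ψ z.1 z.2).toNNReal {j} ∂(mixingMeasure ψ)) •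
      Measure.dirac j

lemma mixedPoisson_singleton (ψ : ℝ → ℝ) (j : ℕ) : mixedPoisson ψ {j} =
    ∫⁻ z, poissonMeasure (mixingRate ψ z.1 z.2).toNNReal {j} ∂(mixingMeasure ψ) := by
  rw [mixedPoisson, Measure.sum_smul_dirac_singleton]

namespace IsDriftlessExponent
variable {ψ : ℝ → ℝ} (h : IsDriftlessExponent ψ)
include h

lemma measurable_poissonMeasure_mixingRate (j : ℕ) :
    Measurable fun z : ℝ × ℝ => poissonMeasure (mixingRate ψ z.1 z.2).toNNReal {j} := by
  have := h.measurable_mixingRate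
  simp only [poissonMeasure_singleton]
  fun_prop

lemma mixedPoisson_singleton_eq (j : ℕ) : mixedPoisson ψ {j} =
    ∫⁻ z in quadrant, ENNReal.ofReal (mixingDensity ψ z.1 z.2) *
      ENNReal.ofReal (Real.exp (-mixingRate ψ z.1 z.2) * mixingRate ψ z.1 z.2 ^ j /
        j.factorial) := by
  rw [mixedPoisson_singleton,
    h.lintegral_mixingMeasure (h.measurable_poissonMeasure_mixingRate j)]
  refine setLIntegral_congr_fun measurableSet_quadrant fun z hz => ?_
  simp only [poissonMeasure_singleton, Real.coe_toNNReal _ (h.mixingRate_nonneg hz.1 (le_of_lt hz.2))]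

lemma isProbabilityMeasure_mixedPoisson : IsProbabilityMeasure (mixedPoisson ψ) := by
  have := h.isProbabilityMeasure_mixingMeasure
  refine ⟨?_⟩
  rw [← Measure.tsum_indicator_apply_singleton _ _ MeasurableSet.univ]
  simp only [indicator_univ, mixedPoisson_singleton]
  rw [← lintegral_tsum fun j => (h.measurable_poissonMeasure_mixingRate j).aemeasurable]
  have : ∀ r : ℝ≥0, ∑' j, poissonMeasure r {j} = 1 := fun r => by
    rw [← measure_univ (μ := poissonMeasure r),
      ← Measure.tsum_indicator_apply_singleton _ _ MeasurableSet.univ]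
    simp
  simp [this]

/-- Fatou's lemma for the probabilities of the single values. -/
lemma mixedPoisson_singleton_le_liminf (j : ℕ) :
    mixedPoisson ψ {j} ≤ liminf (fun m : ℕ => ∫⁻ z in quadrant,
      ENNReal.ofReal (tiltedDensity ψ (1 / ((m : ℝ) + 1)) z.1 z.2) *
      ENNReal.ofReal (binomialWeight m
        (1 - Real.exp (-(1 / ((m : ℝ) + 1)) * mixingRate ψ z.1 z.2)) j)) atTop := by
  rw [h.mixedPoisson_singleton_eq]
  refine le_trans (le_of_eq ?_) (lintegral_liminf_le fun m =>
    (h.measurable_tiltedDensity _).ennreal_ofReal.mul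
      (measurable_binomialWeight h _ _ _).ennreal_ofReal)
  refine setLIntegral_congr_fun measurableSet_quadrant fun z hz => ?_
  exact (ENNReal.Tendsto.mul (ENNReal.tendsto_ofReal (tendsto_tiltedDensity ψ z.1 z.2))
    (Or.inr ENNReal.ofReal_ne_top) (ENNReal.tendsto_ofReal (tendsto_binomialWeight _ j))
    (Or.inr ENNReal.ofReal_ne_top)).liminf_eq.symm

/-- Integrals against the mixed Poisson law. -/
lemma lintegral_mixedPoisson (F : ℕ → ℝ≥0∞) :
    ∫⁻ j, F j ∂(mixedPoisson ψ) = ∫⁻ z in quadrant, ENNReal.ofReal (mixingDensity ψ z.1 z.2) *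
      ∑' j, F j * ENNReal.ofReal (Real.exp (-mixingRate ψ z.1 z.2) * mixingRate ψ z.1 z.2 ^ j /
        j.factorial) := by
  have hm := h.measurable_mixingRate
  have hd := h.measurable_mixingDensity
  have hp : ∀ j : ℕ, Measurable fun z : ℝ × ℝ => ENNReal.ofReal
      (Real.exp (-mixingRate ψ z.1 z.2) * mixingRate ψ z.1 z.2 ^ j / j.factorial) := fun j => by
    fun_prop
  have hm' : ∀ j : ℕ, AEMeasurable (fun z : ℝ × ℝ => ENNReal.ofReal (mixingDensity ψ z.1 z.2) *
      (F j * ENNReal.ofReal (Real.exp (-mixingRate ψ z.1 z.2) * mixingRate ψ z.1 z.2 ^ j /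
        j.factorial))) (volume.restrict quadrant) := fun j =>
    (hd.ennreal_ofReal.mul ((hp j).const_mul _)).aemeasurable
  rw [lintegral_countable']
  simp only [h.mixedPoisson_singleton_eq, ← ENNReal.tsum_mul_left]
  rw [lintegral_tsum hm']
  refine tsum_congr fun j => ?_
  have hdp : Measurable fun z : ℝ × ℝ => ENNReal.ofReal (mixingDensity ψ z.1 z.2) *
      ENNReal.ofReal (Real.exp (-mixingRate ψ z.1 z.2) * mixingRate ψ z.1 z.2 ^ j /
        j.factorial) := hd.ennreal_ofReal.mul (hp j)
  rw [← lintegral_const_mul _ hdp]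
  refine lintegral_congr fun z => ?_
  ring

/-- The Laplace transform of the mixed Poisson law. -/
lemma lintegral_exp_mixedPoisson (s : ℝ) :
    ∫⁻ j, ENNReal.ofReal (Real.exp (-s * (j : ℝ))) ∂(mixedPoisson ψ) =
      ∫⁻ z in quadrant, ENNReal.ofReal (-laplaceIntegrand ψ s z.1 z.2) := by
  rw [h.lintegral_mixedPoisson]
  refine setLIntegral_congr_fun measurableSet_quadrant fun z hz => ?_
  have hr := h.mixingRate_nonneg hz.1 (le_of_lt hz.2)
  set r := mixingRate ψ z.1 z.2 with hrdef
  have hsum : HasSum (fun j : ℕ => Real.exp (-s * (j : ℝ)) *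
      (Real.exp (-r) * r ^ j / j.factorial)) (Real.exp (-r) * Real.exp (Real.exp (-s) * r)) := by
    have := (NormedSpace.expSeries_div_hasSum_exp (Real.exp (-s) * r)).mul_left (Real.exp (-r))
    rw [← Real.exp_eq_exp_ℝ] at this
    refine this.congr_fun fun j => ?_
    rw [mul_pow, ← Real.exp_nat_mul]
    ring_nf
  have h1 : ∀ j : ℕ, ENNReal.ofReal (Real.exp (-s * (j : ℝ))) *
      ENNReal.ofReal (Real.exp (-r) * r ^ j / j.factorial) =
      ENNReal.ofReal (Real.exp (-s * (j : ℝ)) * (Real.exp (-r) * r ^ j / j.factorial)) :=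
    fun j => (ENNReal.ofReal_mul (Real.exp_pos _).le).symm
  simp only [h1]
  rw [← ENNReal.ofReal_tsum_of_nonneg (fun j => by positivity) hsum.summable, hsum.tsum_eq,
    ← ENNReal.ofReal_mul (h.mixingDensity_nonneg hz.1 (le_of_lt hz.2))]
  congr 1
  have e : Real.exp (-ψ z.1) * Real.exp (-r) = Real.exp (-ψ (z.1 + z.2)) := by
    rw [← Real.exp_add, hrdef, mixingRate]; ring_nf
  have e' : Real.exp (-s) * r = -Real.exp (-s) * (ψ z.1 - ψ (z.1 + z.2)) := by
    rw [hrdef, mixingRate]; ring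
  rw [mixingDensity, laplaceIntegrand, ← e, ← e']
  ring

lemma laplaceIntegrand_nonpos {s : ℝ} {z : ℝ × ℝ} (hz : z ∈ quadrant) :
    laplaceIntegrand ψ s z.1 z.2 ≤ 0 :=
  mul_nonpos_of_nonpos_of_nonneg (mul_nonpos_of_nonpos_of_nonneg
    (h.deriv_deriv_nonpos _ (add_pos hz.1 hz.2)) (Real.exp_pos _).le) (Real.exp_pos _).le

lemma measurable_laplaceIntegrand (s : ℝ) :
    Measurable fun z : ℝ × ℝ => laplaceIntegrand ψ s z.1 z.2 := by
  have h1 := h.measurable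
  have h2 := measurable_deriv (deriv ψ)
  unfold laplaceIntegrand; fun_prop

end IsDriftlessExponent

lemma neg_momentIntegrand_eq (ψ : ℝ → ℝ) (l : ℕ) (x y : ℝ) : -momentIntegrand ψ l x y =
    mixingDensity ψ x y * mixingRate ψ x y ^ l := by
  rw [momentIntegrand, mixingDensity, mixingRate]; ring

/-- A nonpositive function on the quadrant whose negative has finite lower integral is integrable,
and the iterated integral is given by the lower integral. -/
lemma integrableOn_quadrant_of_nonpos {F : ℝ → ℝ → ℝ} (hF : Measurable fun z : ℝ × ℝ => F z.1 z.2)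
    (hn : ∀ z ∈ quadrant, F z.1 z.2 ≤ 0)
    (hfin : ∫⁻ z in quadrant, ENNReal.ofReal (-F z.1 z.2) ≠ ∞) :
    IntegrableOn (fun z : ℝ × ℝ => F z.1 z.2) quadrant ∧
      -∫ y in Ioi (0 : ℝ), ∫ x in Ioi (0 : ℝ), F x y =
        (∫⁻ z in quadrant, ENNReal.ofReal (-F z.1 z.2)).toReal := by
  have h0 : 0 ≤ᵐ[volume.restrict quadrant] fun z : ℝ × ℝ => -F z.1 z.2 :=
    (ae_restrict_mem measurableSet_quadrant).mono fun z hz => neg_nonneg.2 (hn z hz)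
  have hint : IntegrableOn (fun z : ℝ × ℝ => -F z.1 z.2) quadrant :=
    (lintegral_ofReal_ne_top_iff_integrable hF.neg.aestronglyMeasurable h0).1 hfin
  have hint' : IntegrableOn (fun z : ℝ × ℝ => F z.1 z.2) quadrant := by simpa using hint.neg
  refine ⟨hint', ?_⟩
  rw [← integral_eq_lintegral_of_nonneg_ae h0 hF.neg.aestronglyMeasurable, integral_neg]
  rw [IntegrableOn, volume_restrict_quadrant] at hint'
  rw [volume_restrict_quadrant, integral_prod_symm _ hint']

namespace IsDriftlessExponent
variable {ψ : ℝ → ℝ} (h : IsDriftlessExponent ψ)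
include h

lemma integral_exp_mixedPoisson {s : ℝ} (hs : 0 ≤ s) :
    IntegrableOn (fun z : ℝ × ℝ => laplaceIntegrand ψ s z.1 z.2) quadrant ∧
      ∫ j : ℕ, Real.exp (-s * (j : ℝ)) ∂(mixedPoisson ψ) = limitLaplace ψ s := by
  have := h.isProbabilityMeasure_mixedPoisson
  have hfin : ∫⁻ z in quadrant, ENNReal.ofReal (-laplaceIntegrand ψ s z.1 z.2) ≠ ∞ := by
    rw [← h.lintegral_exp_mixedPoisson]
    refine ne_top_of_le_ne_top ENNReal.one_ne_top ?_
    calc _ ≤ ∫⁻ j : ℕ, 1 ∂(mixedPoisson ψ) := lintegral_mono fun j =>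
          ENNReal.ofReal_le_one.2 (Real.exp_le_one_iff.2 (by
            have : (0 : ℝ) ≤ s * j := by positivity
            linarith))
      _ = 1 := by simp
  have key := integrableOn_quadrant_of_nonpos (h.measurable_laplaceIntegrand s)
    (fun z hz => h.laplaceIntegrand_nonpos hz) hfin
  refine ⟨key.1, ?_⟩
  rw [limitLaplace, key.2, ← h.lintegral_exp_mixedPoisson,
    integral_eq_lintegral_of_nonneg_ae (Eventually.of_forall fun j => (Real.exp_pos _).le)
      (by fun_prop)]

/-- Fatou's lemma transfers the boundedness of the integrals `I_n(l)` to their limit. -/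
lemma setLIntegral_momentKernel_zero_lt_top {l : ℕ}
    (hI : (⨆ (n : ℕ) (_ : 1 ≤ n), mtfI ψ n l) < ∞) :
    ∫⁻ z in quadrant, ENNReal.ofReal (momentKernel ψ 0 l z.1 z.2) < ∞ := by
  let g : ℝ → ℝ × ℝ → ℝ := fun ε z => deriv ψ (z.1 + z.2) ^ 2 * Real.exp (-ψ z.1) *
    Real.exp (-(2 * ε) * mixingRate ψ z.1 z.2) * mixingRate ψ z.1 z.2 ^ (l - 1)
  have hgm : ∀ ε, Measurable (g ε) := by
    intro ε
    have h1 := h.measurable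
    have h2 := measurable_deriv ψ
    have h4 := h.measurable_mixingRate
    fun_prop
  have hgc : ∀ z, Continuous fun ε => g ε z := fun z => by fun_prop
  have hg : ∀ m : ℕ, ∫⁻ z in quadrant, ENNReal.ofReal (g (1 / ((m : ℝ) + 1)) z) =
      mtfI ψ (m + 1) l := by
    intro m
    rw [setLIntegral_quadrant (hgm _).ennreal_ofReal, mtfI]
    refine setLIntegral_congr_fun measurableSet_Ioi fun x _ => ?_
    rw [← lintegral_const_mul' _ _ ENNReal.ofReal_ne_top]
    refine lintegral_congr fun y => ?_
    rw [← ENNReal.ofReal_mul (Real.exp_pos _).le]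
    congr 1
    have hm : (m : ℝ) + 1 ≠ 0 := by positivity
    have e : Real.exp (-ψ x) * Real.exp (-(2 * (1 / ((m : ℝ) + 1))) * mixingRate ψ x y) =
        Real.exp (-((((m + 1 : ℕ) : ℝ) - 2) / (m + 1 : ℕ)) * ψ x) *
          Real.exp (-(2 / ((m + 1 : ℕ) : ℝ)) * ψ (x + y)) := by
      rw [← Real.exp_add, ← Real.exp_add, mixingRate]
      congr 1
      push_cast
      field_simp
      ring
    simp only [g, mixingRate] at e ⊢
    linear_combination deriv ψ (x + y) ^ 2 * (ψ (x + y) - ψ x) ^ (l - 1) * e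
  have hfatou : ∫⁻ z in quadrant, ENNReal.ofReal (g 0 z) < ∞ := by
    refine lt_of_le_of_lt ?_ hI
    calc ∫⁻ z in quadrant, ENNReal.ofReal (g 0 z) = ∫⁻ z in quadrant,
          liminf (fun m : ℕ => ENNReal.ofReal (g (1 / ((m : ℝ) + 1)) z)) atTop := by
          refine lintegral_congr fun z => ?_
          exact (ENNReal.tendsto_ofReal (((hgc z).tendsto 0).comp
            tendsto_one_div_succ)).liminf_eq.symm
      _ ≤ liminf (fun m : ℕ => ∫⁻ z in quadrant, ENNReal.ofReal (g (1 / ((m : ℝ) + 1)) z)) atTop :=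
          lintegral_liminf_le fun m => (hgm _).ennreal_ofReal
      _ ≤ _ := by
          refine liminf_le_of_le (by isBoundedDefault) fun b hb => ?_
          obtain ⟨m, hm⟩ := hb.exists
          rw [hg] at hm
          exact hm.trans (le_iSup₂_of_le (m + 1) (by omega) le_rfl)
  have e : ∀ z : ℝ × ℝ, ENNReal.ofReal (momentKernel ψ 0 l z.1 z.2) =
      ENNReal.ofReal l * ENNReal.ofReal (g 0 z) := fun z => by
    rw [← ENNReal.ofReal_mul l.cast_nonneg, momentKernel, tiltedRate_zero_left]
  simp only [e]
  rw [lintegral_const_mul' _ _ ENNReal.ofReal_ne_top]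
  exact ENNReal.mul_lt_top ENNReal.ofReal_lt_top hfatou

lemma measurable_momentIntegrand (l : ℕ) :
    Measurable fun z : ℝ × ℝ => momentIntegrand ψ l z.1 z.2 := by
  have h1 := h.measurable
  have h2 := measurable_deriv (deriv ψ)
  unfold momentIntegrand; fun_prop

/-- The moment integral of the limit, integrated by parts. -/
lemma setLIntegral_momentIntegrand {l : ℕ} (hl : 1 ≤ l) :
    ∫⁻ z in quadrant, ENNReal.ofReal (-momentIntegrand ψ l z.1 z.2) =
      ∫⁻ z in quadrant, ENNReal.ofReal (momentKernel ψ 0 l z.1 z.2) := by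
  rw [← h.setLIntegral_tiltedDensity_mul_pow le_rfl hl]
  simp only [neg_momentIntegrand_eq, tiltedDensity_zero, tiltedRate_zero_left]

lemma integrableOn_momentIntegrand {l : ℕ} (hl : 1 ≤ l)
    (hI : (⨆ (n : ℕ) (_ : 1 ≤ n), mtfI ψ n l) < ∞) :
    IntegrableOn (fun z : ℝ × ℝ => momentIntegrand ψ l z.1 z.2) quadrant ∧
      mtfPsi ψ l = (∫⁻ z in quadrant, ENNReal.ofReal (momentKernel ψ 0 l z.1 z.2)).toReal := by
  rw [← h.setLIntegral_momentIntegrand hl]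
  refine integrableOn_quadrant_of_nonpos (h.measurable_momentIntegrand l) (fun z hz => ?_) ?_
  · have := mul_nonneg (h.mixingDensity_nonneg hz.1 (le_of_lt hz.2))
      (pow_nonneg (h.mixingRate_nonneg hz.1 (le_of_lt hz.2)) l)
    rw [← neg_momentIntegrand_eq] at this
    linarith
  · rw [h.setLIntegral_momentIntegrand hl]
    exact (h.setLIntegral_momentKernel_zero_lt_top hI).ne

/-- Dominated convergence, with the limit itself as the bound. -/
lemma tendsto_setLIntegral_momentKernel {l : ℕ}
    (hI : (⨆ (n : ℕ) (_ : 1 ≤ n), mtfI ψ n l) < ∞) :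
    Tendsto (fun m : ℕ => ∫⁻ z in quadrant,
      ENNReal.ofReal (momentKernel ψ (1 / ((m : ℝ) + 1)) l z.1 z.2)) atTop
      (𝓝 (∫⁻ z in quadrant, ENNReal.ofReal (momentKernel ψ 0 l z.1 z.2))) := by
  refine tendsto_lintegral_of_dominated_convergence
    (fun z => ENNReal.ofReal (momentKernel ψ 0 l z.1 z.2))
    (fun m => (h.measurable_momentKernel _ l).ennreal_ofReal) (fun m => ?_)
    (h.setLIntegral_momentKernel_zero_lt_top hI).ne (Eventually.of_forall fun z => ?_)
  · refine (ae_restrict_mem measurableSet_quadrant).mono fun z hz => ENNReal.ofReal_le_ofReal ?_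
    have hr := h.mixingRate_nonneg hz.1 (le_of_lt hz.2)
    have hε : (0 : ℝ) ≤ 1 / ((m : ℝ) + 1) := by positivity
    have h0 := tiltedRate_nonneg hε hr
    simp only [momentKernel, tiltedRate_zero_left]
    have h1 := tiltedRate_le (r := mixingRate ψ z.1 z.2) hε
    gcongr
  · refine ENNReal.tendsto_ofReal ?_
    have h1 := (tendsto_tiltedRate (mixingRate ψ z.1 z.2)).comp tendsto_one_div_succ
    have h2 : Continuous fun ε : ℝ => deriv ψ (z.1 + z.2) ^ 2 * Real.exp (-ψ z.1) *
      Real.exp (-(2 * ε) * mixingRate ψ z.1 z.2) := by fun_prop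
    have := (((h2.tendsto 0).comp tendsto_one_div_succ).mul (h1.pow (l - 1))).const_mul (l : ℝ)
    simpa only [momentKernel, tiltedRate_zero_left, Function.comp_def] using this

end IsDriftlessExponent

/-! ### Convergence of the search cost -/

section convergence
variable {Ω : Type*} [MeasurableSpace Ω] {P : Measure Ω} {ψ : ℝ → ℝ}

/-- The factorial moments of the search cost, integrated by parts. -/
lemma IsDriftlessExponent.lintegral_descFactorial (h : IsDriftlessExponent ψ) {m : ℕ} {S : Ω → ℕ}
    (hSm : Measurable S) (hlaw : ∀ j : ℕ, P {ω | S ω = j} = ∫⁻ z in quadrant,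
      ENNReal.ofReal (tiltedDensity ψ (1 / ((m : ℝ) + 1)) z.1 z.2) *
      ENNReal.ofReal (binomialWeight m
        (1 - Real.exp (-(1 / ((m : ℝ) + 1)) * mixingRate ψ z.1 z.2)) j)) {l : ℕ} (hl : 1 ≤ l) :
    ∫⁻ ω, ((S ω).descFactorial l : ℝ≥0∞) ∂P =
      ENNReal.ofReal (m.descFactorial l / ((m : ℝ) + 1) ^ l) * ∫⁻ z in quadrant,
        ENNReal.ofReal (momentKernel ψ (1 / ((m : ℝ) + 1)) l z.1 z.2) := by
  set ε : ℝ := 1 / ((m : ℝ) + 1) with hε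
  have hε0 : 0 ≤ ε := by positivity
  have hm0 : (m : ℝ) + 1 ≠ 0 := by positivity
  have hmeas : ∀ j, Measurable fun z : ℝ × ℝ => ENNReal.ofReal (tiltedDensity ψ ε z.1 z.2) *
      ENNReal.ofReal (binomialWeight m (1 - Real.exp (-ε * mixingRate ψ z.1 z.2)) j) := fun j =>
    (h.measurable_tiltedDensity ε).ennreal_ofReal.mul
      (measurable_binomialWeight h m j ε).ennreal_ofReal
  have h1 : ∫⁻ ω, ((S ω).descFactorial l : ℝ≥0∞) ∂P =
      ∑' j : ℕ, (j.descFactorial l : ℝ≥0∞) * P {ω | S ω = j} := by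
    rw [← lintegral_map (f := fun j : ℕ => (j.descFactorial l : ℝ≥0∞)) .of_discrete hSm,
      lintegral_countable']
    refine tsum_congr fun j => ?_
    rw [Measure.map_apply hSm (measurableSet_singleton j)]
    rfl
  have h2 : ∀ j ∉ Finset.range (m + 1), (j.descFactorial l : ℝ≥0∞) * P {ω | S ω = j} = 0 := by
    intro j hj
    have : m < j := by simpa [Nat.succ_le_iff] using hj
    simp [hlaw, binomialWeight, Nat.choose_eq_zero_of_lt this]
  rw [h1, tsum_eq_sum h2, ← h.setLIntegral_tiltedDensity_mul_pow hε0 hl,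
    ← lintegral_const_mul' _ _ ENNReal.ofReal_ne_top]
  simp only [hlaw]
  rw [Finset.sum_congr rfl fun j _ => (lintegral_const_mul _ (hmeas j)).symm,
    ← lintegral_finsetSum _ fun j _ => (hmeas j).const_mul _]
  refine setLIntegral_congr_fun measurableSet_quadrant fun z hz => ?_
  have hr := h.mixingRate_nonneg hz.1 (le_of_lt hz.2)
  have hd := h.tiltedDensity_nonneg hε0 hz.1 (le_of_lt hz.2)
  have hb := binomialWeight_nonneg (m := m) (one_sub_exp_mem_Icc hε0 hr)
  have hterm : ∀ j : ℕ, (j.descFactorial l : ℝ≥0∞) *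
      (ENNReal.ofReal (tiltedDensity ψ ε z.1 z.2) *
        ENNReal.ofReal (binomialWeight m (1 - Real.exp (-ε * mixingRate ψ z.1 z.2)) j)) =
      ENNReal.ofReal (tiltedDensity ψ ε z.1 z.2 * (j.descFactorial l *
        binomialWeight m (1 - Real.exp (-ε * mixingRate ψ z.1 z.2)) j)) := by
    intro j
    rw [ENNReal.ofReal_mul hd, ENNReal.ofReal_mul (Nat.cast_nonneg _), ENNReal.ofReal_natCast]
    ring
  simp only [hterm]
  rw [← ENNReal.ofReal_sum_of_nonneg fun j _ =>
      mul_nonneg hd (mul_nonneg (Nat.cast_nonneg _) (hb j)), ← Finset.mul_sum,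
    sum_descFactorial_mul_binomialWeight, ← ENNReal.ofReal_mul (by positivity)]
  congr 1
  rw [hε, tiltedRate_one_div_succ, mul_pow]
  field_simp

lemma tendsto_descFactorial_div_pow (l : ℕ) :
    Tendsto (fun m : ℕ => (m.descFactorial l : ℝ) / ((m : ℝ) + 1) ^ l) atTop (𝓝 1) := by
  induction l with
  | zero => simp
  | succ l ih =>
    have h1 : Tendsto (fun m : ℕ => 1 - ((l : ℝ) + 1) * (1 / ((m : ℝ) + 1))) atTop (𝓝 1) := by
      simpa using (tendsto_one_div_succ.const_mul ((l : ℝ) + 1)).const_sub 1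
    have h2 := h1.mul ih
    rw [one_mul] at h2
    refine h2.congr' ?_
    filter_upwards [eventually_ge_atTop l] with m hm
    have : (m : ℝ) + 1 ≠ 0 := by positivity
    rw [Nat.descFactorial_succ]
    push_cast [hm]
    field_simp
    ring

/-- Convergence of the moments, through the falling factorials. -/
lemma IsDriftlessExponent.tendsto_integral_pow (h : IsDriftlessExponent ψ) {S : ℕ → Ω → ℕ}
    (hSm : ∀ m, Measurable (S m)) (hlaw : ∀ m j : ℕ, P {ω | S m ω = j} = ∫⁻ z in quadrant,
      ENNReal.ofReal (tiltedDensity ψ (1 / ((m : ℝ) + 1)) z.1 z.2) *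
      ENNReal.ofReal (binomialWeight m
        (1 - Real.exp (-(1 / ((m : ℝ) + 1)) * mixingRate ψ z.1 z.2)) j)) {k : ℕ} (hk : 1 ≤ k)
    (hI : ∀ l : ℕ, 1 ≤ l → l ≤ k → (⨆ (n : ℕ) (_ : 1 ≤ n), mtfI ψ n l) < ∞) :
    Tendsto (fun m : ℕ => ∫ ω, (S m ω : ℝ) ^ k ∂P) atTop
      (𝓝 (∑ l ∈ Finset.Icc 1 k, (Nat.stirlingSecond k l : ℝ) * mtfPsi ψ l)) := by
  have hfin : ∀ l ∈ Finset.Icc 1 k,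
      ∫⁻ z in quadrant, ENNReal.ofReal (momentKernel ψ 0 l z.1 z.2) ≠ ∞ := fun l hl =>
    (h.setLIntegral_momentKernel_zero_lt_top
      (hI l (Finset.mem_Icc.1 hl).1 (Finset.mem_Icc.1 hl).2)).ne
  have hst : ∀ j : ℕ, j ^ k = ∑ l ∈ Finset.Icc 1 k, Nat.stirlingSecond k l * j.descFactorial l := by
    intro j
    rw [pow_eq_sum_stirlingSecond_mul_descFactorial, Finset.range_eq_Ico,
      Finset.sum_eq_sum_Ico_succ_bot (Nat.succ_pos k)]
    obtain ⟨k, rfl⟩ := Nat.exists_eq_add_of_le' hk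
    rw [Nat.stirlingSecond_succ_zero, zero_mul, zero_add]
    rfl
  have hmom : ∀ m, ∫ ω, (S m ω : ℝ) ^ k ∂P = (∑ l ∈ Finset.Icc 1 k,
      (Nat.stirlingSecond k l : ℝ≥0∞) * ∫⁻ ω, ((S m ω).descFactorial l : ℝ≥0∞) ∂P).toReal := by
    intro m
    have hdm : ∀ l, Measurable fun ω => ((S m ω).descFactorial l : ℝ≥0∞) := fun l =>
      (Measurable.of_discrete (f := fun j : ℕ => (j.descFactorial l : ℝ≥0∞))).comp (hSm m)
    have hpm : Measurable fun ω => (S m ω : ℝ) ^ k :=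
      (Measurable.of_discrete (f := fun j : ℕ => (j : ℝ) ^ k)).comp (hSm m)
    rw [integral_eq_lintegral_of_nonneg_ae (Eventually.of_forall fun ω => by positivity)
      hpm.aestronglyMeasurable]
    congr 1
    simp only [← lintegral_const_mul _ (hdm _)]
    rw [← lintegral_finsetSum _ fun l _ => (hdm l).const_mul _]
    refine lintegral_congr fun ω => ?_
    rw [← Nat.cast_pow, ENNReal.ofReal_natCast, hst]
    push_cast
    rfl
  have hlim : Tendsto (fun m => ∑ l ∈ Finset.Icc 1 k,
      (Nat.stirlingSecond k l : ℝ≥0∞) * ∫⁻ ω, ((S m ω).descFactorial l : ℝ≥0∞) ∂P) atTop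
      (𝓝 (∑ l ∈ Finset.Icc 1 k, (Nat.stirlingSecond k l : ℝ≥0∞) *
        ∫⁻ z in quadrant, ENNReal.ofReal (momentKernel ψ 0 l z.1 z.2))) := by
    refine tendsto_finsetSum _ fun l hl => ?_
    obtain ⟨hl1, hlk⟩ := Finset.mem_Icc.1 hl
    refine ENNReal.Tendsto.const_mul ?_ (Or.inr (ENNReal.natCast_ne_top _))
    simp only [fun m => h.lintegral_descFactorial (hSm m) (hlaw m) hl1]
    have h1 := ENNReal.tendsto_ofReal (tendsto_descFactorial_div_pow l)
    rw [ENNReal.ofReal_one] at h1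
    simpa using ENNReal.Tendsto.mul h1 (Or.inl one_ne_zero)
      (h.tendsto_setLIntegral_momentKernel (hI l hl1 hlk)) (Or.inr ENNReal.one_ne_top)
  have hne : ∀ l ∈ Finset.Icc 1 k, (Nat.stirlingSecond k l : ℝ≥0∞) *
      ∫⁻ z in quadrant, ENNReal.ofReal (momentKernel ψ 0 l z.1 z.2) ≠ ∞ := fun l hl =>
    ENNReal.mul_ne_top (ENNReal.natCast_ne_top _) (hfin l hl)
  have := (ENNReal.tendsto_toReal (ENNReal.sum_ne_top.2 hne)).comp hlim
  rw [ENNReal.toReal_sum hne] at this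
  simp only [hmom]
  refine this.trans_eq (congrArg 𝓝 (Finset.sum_congr rfl fun l hl => ?_))
  obtain ⟨hl1, hlk⟩ := Finset.mem_Icc.1 hl
  rw [ENNReal.toReal_mul, ENNReal.toReal_natCast,
    (h.integrableOn_momentIntegrand hl1 (hI l hl1 hlk)).2]

variable [IsProbabilityMeasure P]

/-- Weak convergence of the binomial mixtures. Since the limit is a probability measure, the lower
bounds given by Fatou's lemma on open sets suffice. -/
lemma IsDriftlessExponent.tendstoInDistribution (h : IsDriftlessExponent ψ) {S : ℕ → Ω → ℕ}
    (hSm : ∀ m, Measurable (S m)) (hlaw : ∀ m j : ℕ, P {ω | S m ω = j} = ∫⁻ z in quadrant,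
      ENNReal.ofReal (tiltedDensity ψ (1 / ((m : ℝ) + 1)) z.1 z.2) *
      ENNReal.ofReal (binomialWeight m
        (1 - Real.exp (-(1 / ((m : ℝ) + 1)) * mixingRate ψ z.1 z.2)) j))
    [IsProbabilityMeasure (mixedPoisson ψ)] :
    TendstoInDistribution S atTop (fun j : ℕ => j) (fun _ => P) (mixedPoisson ψ) where
  forall_aemeasurable m := (hSm m).aemeasurable
  aemeasurable_limit := measurable_id.aemeasurable
  tendsto := by
    refine tendsto_of_forall_isOpen_le_liminf' fun G _ => ?_
    simp only [ProbabilityMeasure.coe_mk]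
    have hsing : ∀ m j : ℕ, P.map (S m) {j} = P {ω | S m ω = j} := fun m j =>
      Measure.map_apply (hSm m) (measurableSet_singleton j)
    have hid : (mixedPoisson ψ).map (fun j : ℕ => j) = mixedPoisson ψ := Measure.map_id
    rw [hid, ← Measure.tsum_indicator_apply_singleton _ _ (.of_discrete : MeasurableSet G)]
    simp only [← Measure.tsum_indicator_apply_singleton _ _ (.of_discrete : MeasurableSet G),
      ← lintegral_count]
    refine le_trans (lintegral_mono fun j => ?_) (lintegral_liminf_le fun m => .of_discrete)
    by_cases hj : j ∈ G
    · simp only [indicator_of_mem hj, hsing, hlaw]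
      exact h.mixedPoisson_singleton_le_liminf j
    · simp [indicator_of_notMem hj]

end convergence

theorem theorem3 {Ω : Type*} [MeasurableSpace Ω] (P : Measure Ω) [IsProbabilityMeasure P]
    (ξ : ℝ → Ω → ℝ) (hξ : IsSubordinator P ξ)
    (ν : Measure ℝ) (hν : HasLevyMeasure P ξ ν) (hν_inf : ν (Ioi 0) = ∞)
    (ψ : ℝ → ℝ) (hψ : ψ = laplaceExponent P ξ)
    (S : ℕ → Ω → ℕ)
    (hS : ∀ n : ℕ, 1 ≤ n → IsStationarySearchCost P (incrementWeights ξ n) (S n)) :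
    ContDiffOn ℝ 2 ψ (Ioi 0) ∧
    (∃ (μ : Measure ℕ) (_ : IsProbabilityMeasure μ),
      -- convergence in distribution to a random variable with law `μ`
      TendstoInDistribution (fun n : ℕ => S (n + 1)) atTop (fun j : ℕ => j) (fun _ => P) μ ∧
      -- the limiting Laplace transform
      (∀ s : ℝ, 0 ≤ s →
        IntegrableOn (fun z : ℝ × ℝ => laplaceIntegrand ψ s z.1 z.2) quadrant ∧
        ∫ j : ℕ, Real.exp (-s * (j : ℝ)) ∂μ = limitLaplace ψ s ∧
        Tendsto (fun n : ℕ => ∫ ω, Real.exp (-s * (S n ω : ℝ)) ∂P) atTop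
          (𝓝 (limitLaplace ψ s))) ∧
      -- the limit is a mixture of Poisson distributions
      (∀ x y : ℝ, 0 < x → 0 < y → 0 ≤ mixingDensity ψ x y ∧ 0 ≤ mixingRate ψ x y) ∧
      IsProbabilityMeasure (mixingMeasure ψ) ∧
      (∀ j : ℕ, μ {j} =
        ∫⁻ z, poissonMeasure (mixingRate ψ z.1 z.2).toNNReal {j} ∂(mixingMeasure ψ))) ∧
    -- convergence of the moments
    (∀ k : ℕ, 1 ≤ k →
      (∀ l : ℕ, 1 ≤ l → l ≤ k → (⨆ (n : ℕ) (_ : 1 ≤ n), mtfI ψ n l) < ∞) →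
      (∀ l : ℕ, 1 ≤ l → l ≤ k →
        IntegrableOn (fun z : ℝ × ℝ => momentIntegrand ψ l z.1 z.2) quadrant) ∧
      Tendsto (fun n : ℕ => ∫ ω, (S n ω : ℝ) ^ k ∂P) atTop
        (𝓝 (∑ l ∈ Finset.Icc 1 k, (Nat.stirlingSecond k l : ℝ) * mtfPsi ψ l))) := by
  subst hψ
  have hE := hξ.isDriftlessExponent hν hν_inf
  have hμ := hE.isProbabilityMeasure_mixedPoisson
  have hSm : ∀ m, Measurable (S (m + 1)) := fun m => (hS (m + 1) (by omega)).measurable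
  have hlaw := fun m : ℕ => hξ.measure_searchCost hν hν_inf (hS (m + 1) (by omega))
  have hdist := hE.tendstoInDistribution hSm hlaw
  refine ⟨hE.contDiffOn, ⟨mixedPoisson _, hμ, hdist, fun s hs => ?_, fun x y hx hy =>
    ⟨hE.mixingDensity_nonneg hx hy.le, hE.mixingRate_nonneg hx hy.le⟩,
    hE.isProbabilityMeasure_mixingMeasure, mixedPoisson_singleton _⟩, fun k hk hI =>
    ⟨fun l hl1 hlk => (hE.integrableOn_momentIntegrand hl1 (hI l hl1 hlk)).1, ?_⟩⟩
  · obtain ⟨hint, heq⟩ := hE.integral_exp_mixedPoisson hs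
    refine ⟨hint, heq, ?_⟩
    let F : BoundedContinuousFunction ℕ ℝ := BoundedContinuousFunction.ofNormedAddCommGroup
      (fun j : ℕ => Real.exp (-s * (j : ℝ))) continuous_of_discreteTopology 1 fun j => by
        rw [Real.norm_eq_abs, Real.abs_exp, Real.exp_le_one_iff]
        have : (0 : ℝ) ≤ s * j := by positivity
        linarith
    have h1 := (ProbabilityMeasure.tendsto_iff_forall_integral_tendsto.1 hdist.tendsto) F
    rw [← tendsto_add_atTop_iff_nat 1, ← heq]
    refine (h1.congr fun m => ?_).trans_eq ?_
    · exact integral_map (hSm m).aemeasurable (by fun_prop)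
    · congr 1
      exact integral_map measurable_id.aemeasurable (by fun_prop)
  · rw [← tendsto_add_atTop_iff_nat 1]
    exact hE.tendsto_integral_pow hSm hlaw hk hI
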